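/- **Theorem.** Let $\mathcal C$ be a class of finite simple graphs of bounded expansion, let $H$ be a finite simple graph, and let $\varepsilon>0$. Then $H$-freeness can be tested on graphs of $\mathcal C$ in the random neighbor model with proximity parameter $\varepsilon$, constant query complexity and one-sided error. That is, there are an integer $q$ and a randomized algorithm $T$ (both may depend on $\mathcal C$, $H$ and $\varepsilon$, but not on the input graph) such that, on every finite input graph $G$, the algorithm $T$ reaches a verdict with probability $1$ and makes at most $q$ oracle queries in every run, and 1. (one-sided error) $T$ accepts every $H$-free graph $G$ with probability $1$; 2. $T$ rejects with probability at least $2/3$ every $G\in\mathcal C$ that is $\varepsilon$-far from being $H$-free. Here the following definitions are used. * *Bounded expansion.* A tree order on $V$ is a partial order in which the elements below any given element are totally ordered. The level of an element is the number of elements strictly below it (so roots have level $0$). A tree embedding of a graph is a tree order on its vertices in which adjacent vertices are comparable, and the treedepth of a graph is the minimum, over its tree embeddings, of the maximal level of a vertex. A $p$-treedepth coloring of $G$ is a coloring of $V(G)$ such that, for every set of $i\le p$ colors, the subgraph induced by the vertices with these colors has treedepth at most $i$. The class $\mathcal C$ has bounded expansion if there is a function $f:\mathbb N\to\mathbb N$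 such that every $G\in\mathcal C$ has, for every $p\in\mathbb N$, a $p$-treedepth coloring with at most $f(p)$ colors. * *$H$-freeness.* $G$ is $H$-free if there is no injective map $V(H)\to V(G)$ sending edges of $H$ to edges of $G$. * *Farness.* $G$ is $\varepsilon$-far from being $H$-free if more than $\varepsilon|V(G)|$ edges have to be deleted from or inserted into $G$ to obtain an $H$-free graph on the vertex set $V(G)$. * *Random neighbor model.* The vertex set of the input graph is $\{0,\dots,n-1\}$ and $n$ is known to the algorithm. The algorithm may toss coins (draw uniformly random numbers from finite ranges $\{0,\dots,k\}$). It accesses the edges only through random neighbor queries: given $v$, the oracle returns a uniformly random neighbor of $v$, independently of all previous answers, or reports that $v$ has no neighbor. Each next move is a computable function of $n$ and of the answers (of the coins and of the oracle) received so far. -/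

import Mathlib

open scoped ENNReal

/-! ### Graph classes, farness -/

/-- A class (or a property) of finite simple graphs. The vertex set of a graph with `n` vertices
is `{0, …, n - 1}`. No closure property (not even closure under isomorphism) is required. -/
abbrev GraphClass : Type := (n : ℕ) → Set (SimpleGraph (Fin n))

/-- The property of being `H`-free: there is no injective map `V(H) → V(G)` that sends edges to
edges (not necessarily induced). -/
def FreeOf {W : Type*} (H : SimpleGraph W) : GraphClass :=
  fun _ => {G | H.Free G}

/-- `G` is `ε`-far from `P`: every graph with property `P` on the same vertex set differs from `G`
by more than `ε * |G|` edge deletions and insertions. -/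
def IsFar (ε : ℝ) (P : GraphClass) {n : ℕ} (G : SimpleGraph (Fin n)) : Prop :=
  ∀ G' ∈ P n, ε * n < ((symmDiff G.edgeSet G'.edgeSet).ncard : ℝ)

/-! ### Treedepth and bounded expansion -/

/-- `r` is a tree order on `V`: a partial order in which the elements below any given element are
totally ordered. -/
structure IsTreeOrder {V : Type*} (r : V → V → Prop) : Prop where
  refl : ∀ v, r v v
  antisymm : ∀ u v, r u v → r v u → u = v
  trans : ∀ u v w, r u v → r v w → r u w
  total_below : ∀ v u w, r u v → r w v → r u w ∨ r w u

/-- A tree embedding of `G`: a tree order for which adjacent vertices are comparable. -/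
def IsTreeEmbedding {V : Type*} (G : SimpleGraph V) (r : V → V → Prop) : Prop :=
  IsTreeOrder r ∧ ∀ u v, G.Adj u v → r u v ∨ r v u

/-- The level of `v`: the number of elements strictly smaller than `v`; roots have level zero. -/
noncomputable def treeLevel {V : Type*} (r : V → V → Prop) (v : V) : ℕ :=
  {u | r u v ∧ u ≠ v}.ncard

/-- The treedepth of a finite graph: the least possible maximal level in a tree embedding. As roots
have level zero, an edgeless graph has treedepth `0` and a single edge has treedepth `1`. -/
noncomputable def treedepth {V : Type*} (G : SimpleGraph V) : ℕ :=
  sInf {d | ∃ r : V → V → Prop, IsTreeEmbedding G r ∧ ∀ v, treeLevel r v ≤ d}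

/-- `c` is a `p`-treedepth coloring of `G`: any `i ≤ p` color classes together induce a subgraph
of treedepth at most `i`. -/
def IsTreedepthColoring {V K : Type*} (p : ℕ) (G : SimpleGraph V) (c : V → K) : Prop :=
  ∀ S : Finset K, S.card ≤ p → treedepth (G.induce {v | c v ∈ S}) ≤ S.card

/-- Bounded expansion: for some function `f`, each graph of the class has, for every `p`, a
`p`-treedepth coloring with at most `f p` colors. -/
def HasBoundedExpansion (C : GraphClass) : Prop :=
  ∃ f : ℕ → ℕ, ∀ n, ∀ G ∈ C n, ∀ p : ℕ, ∃ c : Fin n → Fin (f p), IsTreedepthColoring p G c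

/-! ### Testers in the random neighbor model -/

/-- The possible moves of a tester:
* `inl k`: draw a uniformly random number from `{0, …, k}` (an internal coin toss);
* `inr (inl v)`: make a random neighbor query at the vertex `v`;
* `inr (inr b)`: stop, accepting if `b = true` and rejecting if `b = false`. -/
abbrev Move : Type := ℕ ⊕ ℕ ⊕ Bool

/-- A randomized oracle procedure: from the number of vertices of the input graph (that is, its
vertex set `{0, …, n - 1}`) and the list of all answers received so far, it determines its next
move. -/
abbrev Procedure : Type := ℕ × List (Option ℕ) → Move

open Classical in
/-- The answer to a random neighbor query at `v`: a uniformly random neighbor of `v`; the answer is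
`none` if there is no such neighbor. -/
noncomputable def randomNeighbor {n : ℕ} (G : SimpleGraph (Fin n)) (v : ℕ) : PMF (Option ℕ) :=
  if h : ∃ hv : v < n, (G.neighborFinset ⟨v, hv⟩).Nonempty then
    (PMF.uniformOfFinset _ h.choose_spec).map fun w : Fin n => some w.val
  else PMF.pure none

/-- One step of the procedure `T` on the input `G`. A state consists of the list of the answers
received so far, and of the number of oracle queries made so far. -/
noncomputable def step (T : Procedure) {n : ℕ} (G : SimpleGraph (Fin n))
    (s : List (Option ℕ) × ℕ) : PMF (List (Option ℕ) × ℕ) :=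
  match T (n, s.1) with
  | .inl k => (PMF.uniformOfFintype (Fin (k + 1))).map fun i : Fin (k + 1) => (s.1 ++ [some i.val], s.2)
  | .inr (.inl v) => (randomNeighbor G v).map fun a => (s.1 ++ [a], s.2 + 1)
  | .inr (.inr _) => PMF.pure s

/-- The law of the state of the procedure `T` on the input `G` after `t` steps. -/
noncomputable def run (T : Procedure) {n : ℕ} (G : SimpleGraph (Fin n)) :
    ℕ → PMF (List (Option ℕ) × ℕ)
  | 0 => PMF.pure ([], 0)
  | t + 1 => (run T G t).bind (step T G)

/-- The probability that `T` eventually stops on the input `G` with the verdict `b`: the supremum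
(which is the limit) over `t` of the probability that it has done so after `t` steps. -/
noncomputable def verdictProb (T : Procedure) {n : ℕ} (G : SimpleGraph (Fin n)) (b : Bool) : ℝ≥0∞ :=
  ⨆ t, ((run T G t).map fun s => T (n, s.1)) (.inr (.inr b))

/-- The probability that `T` accepts `G`. -/
noncomputable def acceptProb (T : Procedure) {n : ℕ} (G : SimpleGraph (Fin n)) : ℝ≥0∞ :=
  verdictProb T G true

/-- The probability that `T` rejects `G`. -/
noncomputable def rejectProb (T : Procedure) {n : ℕ} (G : SimpleGraph (Fin n)) : ℝ≥0∞ :=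
  verdictProb T G false

/-- `T` is an algorithm: its moves are computable, and on every input graph it reaches a verdict
with probability one. -/
def IsAlgorithm (T : Procedure) : Prop :=
  Computable T ∧ ∀ (n : ℕ) (G : SimpleGraph (Fin n)), acceptProb T G + rejectProb T G = 1

/-- `T` never makes more than `q` oracle queries, whatever the input graph is. -/
def HasQueryBound (T : Procedure) (q : ℕ) : Prop :=
  ∀ (n : ℕ) (G : SimpleGraph (Fin n)) (t : ℕ), ∀ s ∈ (run T G t).support, s.2 ≤ q

/-- `T` is a tester for the property `P` with proximity parameter `ε` on graphs of `C`. -/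
def IsTester (T : Procedure) (C P : GraphClass) (ε : ℝ) : Prop :=
  IsAlgorithm T ∧ ∀ n, ∀ G ∈ C n,
    (G ∈ P n → 2 / 3 ≤ acceptProb T G) ∧ (IsFar ε P G → 2 / 3 ≤ rejectProb T G)

/-- `T` has one-sided error for `P`: it accepts all graphs with property `P` with probability
one. -/
def HasOneSidedError (T : Procedure) (P : GraphClass) : Prop :=
  ∀ n, ∀ G ∈ P n, acceptProb T G = 1

/-!
Only the edges of a copy of `H` that the tester has found make it reject, so the error is one-sided;
the point is that it finds a copy with a probability that does not depend on the graph.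

In a treedepth coloring with sufficiently many colors, each copy of `H` lies in the union of few
color classes, and on such a union a tree order of bounded height makes adjacent vertices
comparable. By pigeonhole there are thresholds `K < K'` with few edges at the vertices of degree
between them. After deleting few edges, every edge has an end of low degree, the vertices of high
degree have no neighbors below them, and those adjacent to a connected part of bounded size of the
low vertices form a chain.

Consider the copies of `H` in which a given vertex `q` is attached to a given vertex `a` of high
degree (or to a virtual root). As long as one of them has few alternatives, that is, few possible
images of `q` when only the component of `q` is rerouted, detach these alternatives from `a`.
The minimal weight of partial maps needed to represent all copies in question then decreases. This
number is bounded in terms of `H` and of the height, so few edges are deleted altogether. As the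
graph is far from being `H`-free, some copy of `H` survives, and every such copy has a positive
proportion of alternatives wherever it leaves the vertices of low degree.

The tester now extends a partially found copy edge by edge. At a vertex of low degree, a random
neighbor is the next vertex of the copy with probability at least `1 / K`. Otherwise, a component of
the rest of `H` is attached to a chain of high vertices; a random neighbor of the greatest of them
(or a random vertex, if there are none) is an alternative with positive probability, and the copy is
rerouted along it, which respects the edges already found. Hence `|E(H)|` successive queries find a
copy with a probability bounded from below, and constantly many rounds amplify it to `2 / 3`.
-/

/-! ### Tree orders -/

section TreeOrder

variable {V : Type*}

theorem isTreeOrder_of_injective {α : Type*} [LinearOrder α] {f : V → α}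
    (hf : Function.Injective f) : IsTreeOrder fun u v => f u ≤ f v where
  refl _ := le_rfl
  antisymm _ _ huv hvu := hf (le_antisymm huv hvu)
  trans _ _ _ := le_trans
  total_below _ _ _ _ _ := le_total _ _

theorem treeLevel_le_card [Finite V] (r : V → V → Prop) (v : V) : treeLevel r v ≤ Nat.card V :=
  (Set.ncard_le_ncard (Set.subset_univ _) Set.finite_univ).trans (Set.ncard_univ V).le

theorem exists_isTreeEmbedding_treedepth [Finite V] (G : SimpleGraph V) :
    ∃ r : V → V → Prop, IsTreeEmbedding G r ∧ ∀ v, treeLevel r v ≤ treedepth G := by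
  obtain ⟨n, ⟨e⟩⟩ := Finite.exists_equiv_fin V
  exact Nat.sInf_mem (s := {d | ∃ r, IsTreeEmbedding G r ∧ ∀ v, treeLevel r v ≤ d})
    ⟨Nat.card V, _, ⟨isTreeOrder_of_injective e.injective, fun _ _ _ => le_total _ _⟩,
      treeLevel_le_card _⟩

open Classical in
/-- The elements strictly below `v` in the order `r`: there are `treeLevel r v` of them. -/
noncomputable def strictlyBelow [Fintype V] (r : V → V → Prop) (v : V) : Finset V :=
  {u | r u v ∧ u ≠ v}

theorem mem_strictlyBelow [Fintype V] {r : V → V → Prop} {u v : V} :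
    u ∈ strictlyBelow r v ↔ r u v ∧ u ≠ v := by
  simp only [strictlyBelow, Finset.mem_filter_univ]

theorem card_strictlyBelow [Fintype V] (r : V → V → Prop) (v : V) :
    (strictlyBelow r v).card = treeLevel r v := by
  rw [treeLevel, ← Set.ncard_coe_finset]
  congr 1
  ext u
  exact mem_strictlyBelow

/-- The subgraph of `G` formed by the edges with both ends in `S`, on the same vertex set. -/
def within (G : SimpleGraph V) (S : Set V) : SimpleGraph V where
  Adj x y := G.Adj x y ∧ x ∈ S ∧ y ∈ S
  symm := ⟨fun _ _ h => ⟨h.1.symm, h.2.2, h.2.1⟩⟩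
  loopless := ⟨fun _ h => h.1.ne rfl⟩

theorem within_le (G : SimpleGraph V) (S : Set V) : within G S ≤ G :=
  fun _ _ h => h.1

theorem within_mono {G G' : SimpleGraph V} {S S' : Set V} (hG : G ≤ G') (hS : S ⊆ S') :
    within G S ≤ within G' S' :=
  fun _ _ h => ⟨hG h.1, hS h.2.1, hS h.2.2⟩

/-- The extension of an order on `S` to the whole type, in which every element outside `S` is
comparable to itself only. -/
def extendOrder {S : Set V} (r : S → S → Prop) (u v : V) : Prop :=
  u = v ∨ ∃ (hu : u ∈ S) (hv : v ∈ S), r ⟨u, hu⟩ ⟨v, hv⟩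

theorem IsTreeOrder.extendOrder {S : Set V} {r : S → S → Prop} (hr : IsTreeOrder r) :
    IsTreeOrder (extendOrder r) where
  refl _ := Or.inl rfl
  antisymm := by
    rintro u v (h | ⟨hu, hv, h⟩) (h' | ⟨_, _, h'⟩)
    · exact h
    · exact h
    · exact h'.symm
    · exact congrArg Subtype.val (hr.antisymm _ _ h h')
  trans := by
    rintro u v w (rfl | ⟨hu, hv, h⟩) (rfl | ⟨hv', hw, h'⟩)
    · exact Or.inl rfl
    · exact Or.inr ⟨_, _, h'⟩
    · exact Or.inr ⟨_, _, h⟩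
    · exact Or.inr ⟨hu, hw, hr.trans _ _ _ h h'⟩
  total_below := by
    rintro v u w (rfl | ⟨hu, hv, h⟩) (rfl | ⟨hw, hv', h'⟩)
    · exact Or.inl (Or.inl rfl)
    · exact Or.inr (Or.inr ⟨_, _, h'⟩)
    · exact Or.inl (Or.inr ⟨_, _, h⟩)
    · exact (hr.total_below _ _ _ h h').imp (fun h => Or.inr ⟨_, _, h⟩) (fun h => Or.inr ⟨_, _, h⟩)

theorem treeLevel_extendOrder_of_mem [Finite V] {S : Set V} (r : S → S → Prop) (v : S) :
    treeLevel (extendOrder r) v ≤ treeLevel r v := by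
  rw [treeLevel, treeLevel, ← Set.ncard_image_of_injective _ Subtype.val_injective]
  refine Set.ncard_le_ncard ?_ (Set.toFinite _)
  rintro u ⟨rfl | ⟨hu, _, h⟩, hne⟩
  · exact absurd rfl hne
  · exact ⟨⟨u, hu⟩, ⟨h, fun h => hne (congrArg Subtype.val h)⟩, rfl⟩

theorem treeLevel_extendOrder_of_notMem {S : Set V} (r : S → S → Prop) {v : V} (hv : v ∉ S) :
    treeLevel (extendOrder r) v = 0 := by
  have hempty : {u | extendOrder r u v ∧ u ≠ v} = ∅ :=
    Set.eq_empty_of_forall_notMem fun u hu => hu.1.elim hu.2 fun ⟨_, hv', _⟩ => hv hv'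
  rw [treeLevel, hempty, Set.ncard_empty]

theorem exists_isTreeEmbedding_within [Finite V] (G : SimpleGraph V) (S : Set V) :
    ∃ r : V → V → Prop, IsTreeEmbedding (within G S) r ∧
      ∀ v, treeLevel r v ≤ treedepth (G.induce S) := by
  obtain ⟨r, ⟨hr, hadj⟩, hlevel⟩ := exists_isTreeEmbedding_treedepth (G.induce S)
  refine ⟨extendOrder r, ⟨hr.extendOrder, ?_⟩, fun v => ?_⟩
  · rintro u v ⟨h, hu, hv⟩
    exact (hadj ⟨u, hu⟩ ⟨v, hv⟩ h).imp (fun h => Or.inr ⟨_, _, h⟩) (fun h => Or.inr ⟨_, _, h⟩)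
  · by_cases hv : v ∈ S
    · exact (treeLevel_extendOrder_of_mem r ⟨v, hv⟩).trans (hlevel _)
    · exact (treeLevel_extendOrder_of_notMem r hv).trans_le (Nat.zero_le _)

theorem IsTreedepthColoring.mono {K : Type*} {p q : ℕ} (hpq : p ≤ q) {G : SimpleGraph V}
    {c : V → K} (hc : IsTreedepthColoring q G c) : IsTreedepthColoring p G c :=
  fun S hS => hc S (hS.trans hpq)

theorem IsTreedepthColoring.exists_isTreeEmbedding [Finite V] {K : Type*} {p : ℕ}
    {G : SimpleGraph V} {c : V → K} (hc : IsTreedepthColoring p G c) {S : Finset K}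
    (hS : S.card ≤ p) :
    ∃ r : V → V → Prop, IsTreeEmbedding (within G {v | c v ∈ S}) r ∧ ∀ v, treeLevel r v ≤ p := by
  obtain ⟨r, hr, hlevel⟩ := exists_isTreeEmbedding_within G {v | c v ∈ S}
  exact ⟨r, hr, fun v => (hlevel v).trans ((hc S hS).trans hS)⟩

theorem IsTreeEmbedding.exists_least_of_walk {r : V → V → Prop} {G : SimpleGraph V}
    (hr : IsTreeEmbedding G r) {x y : V} (w : G.Walk x y) :
    ∃ m ∈ w.support, ∀ z ∈ w.support, r m z := by
  induction w with
  | @nil u => exact ⟨u, by simp, by simp [hr.1.refl]⟩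
  | @cons x x' y hadj w ih =>
    obtain ⟨m, hm, hmin⟩ := ih
    have hmx' := hmin x' w.start_mem_support
    have hcomp : r x m ∨ r m x := (hr.2 x x' hadj).elim
      (fun hxx' => hr.1.total_below _ _ _ hxx' hmx')
      (fun hx'x => Or.inr (hr.1.trans _ _ _ hmx' hx'x))
    simp only [SimpleGraph.Walk.support_cons, List.mem_cons, exists_eq_or_imp, forall_eq_or_imp]
    rcases hcomp with hxm | hmx
    · exact Or.inl ⟨hr.1.refl x, fun z hz => hr.1.trans _ _ _ hxm (hmin z hz)⟩
    · exact Or.inr ⟨m, hm, hmx, hmin⟩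

end TreeOrder

/-! ### Deleting edges -/

section EdgeLoss

variable {V : Type*}

/-- The number of edges of `G` that are missing in `G'`: the price of passing from `G` to `G'`. -/
noncomputable def edgeLoss (G G' : SimpleGraph V) : ℕ := (G.edgeSet \ G'.edgeSet).ncard

theorem edgeLoss_self (G : SimpleGraph V) : edgeLoss G G = 0 := by
  rw [edgeLoss, sdiff_self, Set.bot_eq_empty, Set.ncard_empty]

theorem edgeLoss_triangle [Finite V] (G₁ G₂ G₃ : SimpleGraph V) :
    edgeLoss G₁ G₃ ≤ edgeLoss G₁ G₂ + edgeLoss G₂ G₃ :=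
  (Set.ncard_le_ncard (sdiff_triangle _ _ _) (Set.toFinite _)).trans (Set.ncard_union_le _ _)

theorem edgeLoss_le_sum_card [Fintype V] {G G' : SimpleGraph V} {N : V → Finset V}
    (hN : ∀ u v, G.Adj u v → ¬ G'.Adj u v → v ∈ N u ∨ u ∈ N v) :
    edgeLoss G G' ≤ ∑ u, (N u).card := by
  classical
  let lost : Finset (Sym2 V) := Finset.univ.biUnion fun u => (N u).image fun v => s(u, v)
  have hlost : G.edgeSet \ G'.edgeSet ⊆ lost := by
    rintro ⟨u, v⟩ ⟨h, h'⟩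
    simp only [lost, Finset.coe_biUnion, Set.mem_iUnion, Finset.coe_image, Set.mem_image]
    rcases hN u v h h' with hv | hu
    · exact ⟨u, Finset.mem_coe.2 (Finset.mem_univ u), v, hv, rfl⟩
    · exact ⟨v, Finset.mem_coe.2 (Finset.mem_univ v), u, hu, Sym2.eq_swap⟩
  calc edgeLoss G G' ≤ (lost : Set (Sym2 V)).ncard := Set.ncard_le_ncard hlost lost.finite_toSet
    _ = lost.card := Set.ncard_coe_finset _
    _ ≤ ∑ u, (N u).card := Finset.card_biUnion_le.trans
      (Finset.sum_le_sum fun u _ => Finset.card_image_le)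

/-- The graph obtained from `G` by deleting, for each vertex `u`, the edges from `u` to `N u`. -/
def cutOff (G : SimpleGraph V) (N : V → Finset V) : SimpleGraph V where
  Adj u v := G.Adj u v ∧ v ∉ N u ∧ u ∉ N v
  symm := ⟨fun _ _ h => ⟨h.1.symm, h.2.2, h.2.1⟩⟩
  loopless := ⟨fun _ h => h.1.ne rfl⟩

theorem cutOff_le (G : SimpleGraph V) (N : V → Finset V) : cutOff G N ≤ G :=
  fun _ _ h => h.1

theorem edgeLoss_cutOff_le [Fintype V] (G : SimpleGraph V) (N : V → Finset V) :
    edgeLoss G (cutOff G N) ≤ ∑ u, (N u).card :=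
  edgeLoss_le_sum_card fun u v h h' => by
    by_contra! hcon
    exact h' ⟨h, hcon⟩

open Classical in
theorem sum_degree_eq_two_mul_edgeLoss_bot [Fintype V] (G : SimpleGraph V) :
    ∑ v, G.degree v = 2 * edgeLoss G ⊥ := by
  rw [SimpleGraph.sum_degrees_eq_twice_card_edges, edgeLoss, SimpleGraph.edgeSet_bot,
    Set.sdiff_empty, ← SimpleGraph.coe_edgeFinset, Set.ncard_coe_finset]

open Classical in
theorem sum_degree_le_of_isTreedepthColoring [Fintype V] {K : Type*} [Fintype K]
    {G : SimpleGraph V} {c : V → K} (hc : IsTreedepthColoring 2 G c) :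
    ∑ v, G.degree v ≤ 4 * 2 ^ Fintype.card K * Fintype.card V := by
  choose r hr hlevel using fun S : {S : Finset K // S.card ≤ 2} => hc.exists_isTreeEmbedding S.2
  let below (v : V) : Finset V := Finset.univ.biUnion fun S => strictlyBelow (r S) v
  have hbelow (v : V) : (below v).card ≤ 2 ^ Fintype.card K * 2 :=
    calc (below v).card ≤ ∑ S, (strictlyBelow (r S) v).card := Finset.card_biUnion_le
      _ ≤ ∑ _S : {S : Finset K // S.card ≤ 2}, 2 :=
        Finset.sum_le_sum fun S _ => (card_strictlyBelow _ _).trans_le (hlevel S v)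
      _ ≤ 2 ^ Fintype.card K * 2 := by
        rw [Finset.sum_const, smul_eq_mul, Finset.card_univ, ← Fintype.card_finset]
        exact Nat.mul_le_mul_right _ (Fintype.card_subtype_le _)
  have hcomparable (u v : V) (huv : G.Adj u v) : v ∈ below u ∨ u ∈ below v := by
    let S : {S : Finset K // S.card ≤ 2} := ⟨{c u, c v}, Finset.card_le_two⟩
    have hadj : (within G {v | c v ∈ S.1}).Adj u v := ⟨huv, by simp [S], by simp [S]⟩
    simp only [below, Finset.mem_biUnion, Finset.mem_univ, true_and, mem_strictlyBelow]
    exact ((hr S).2 u v hadj).symm.imp (fun h => ⟨S, h, huv.ne'⟩) (fun h => ⟨S, h, huv.ne⟩)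
  calc ∑ v, G.degree v = 2 * edgeLoss G ⊥ := sum_degree_eq_two_mul_edgeLoss_bot G
    _ ≤ 2 * ∑ v, (below v).card :=
      Nat.mul_le_mul_left 2 (edgeLoss_le_sum_card fun u v h _ => hcomparable u v h)
    _ ≤ 2 * ∑ _v : V, 2 ^ Fintype.card K * 2 :=
      Nat.mul_le_mul_left 2 (Finset.sum_le_sum fun v _ => hbelow v)
    _ = 4 * 2 ^ Fintype.card K * Fintype.card V := by
      rw [Finset.sum_const, smul_eq_mul, Finset.card_univ]
      ring

end EdgeLoss

/-! ### Separating the vertices of high degree -/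

section Separation

variable {V : Type*}

open Classical in
/-- The closed ball of radius `k` around `m` in the graph metric. -/
noncomputable def walkBall [Fintype V] (G : SimpleGraph V) (k : ℕ) (m : V) : Finset V :=
  {x | ∃ w : G.Walk m x, w.length ≤ k}

theorem mem_walkBall [Fintype V] {G : SimpleGraph V} {k : ℕ} {m x : V} :
    x ∈ walkBall G k m ↔ ∃ w : G.Walk m x, w.length ≤ k := by
  simp only [walkBall, Finset.mem_filter_univ]

theorem walkBall_mono [Fintype V] {G G' : SimpleGraph V} (h : G ≤ G') (k : ℕ) (m : V) :
    walkBall G k m ⊆ walkBall G' k m := fun x hx => by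
  obtain ⟨w, hw⟩ := mem_walkBall.1 hx
  exact mem_walkBall.2 ⟨w.mapLe h, by rwa [SimpleGraph.Walk.length_map]⟩

open Classical in
theorem walkBall_succ_subset [Fintype V] (G : SimpleGraph V) (k : ℕ) (m : V) :
    walkBall G (k + 1) m ⊆ {m} ∪ (G.neighborFinset m).biUnion (walkBall G k) := fun x hx => by
  obtain ⟨w, hw⟩ := mem_walkBall.1 hx
  cases w with
  | nil => exact Finset.mem_union_left _ (Finset.mem_singleton_self _)
  | @cons _ m' _ h w =>
    rw [SimpleGraph.Walk.length_cons] at hw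
    exact Finset.mem_union_right _ (Finset.mem_biUnion.2
      ⟨m', (G.mem_neighborFinset m m').2 h, mem_walkBall.2 ⟨w, Nat.le_of_succ_le_succ hw⟩⟩)

open Classical in
theorem card_walkBall_le [Fintype V] {G : SimpleGraph V} {K : ℕ} (hK : ∀ v, G.degree v ≤ K)
    (k : ℕ) (m : V) : (walkBall G k m).card ≤ (K + 1) ^ k := by
  induction k generalizing m with
  | zero =>
    refine (Finset.card_le_card (t := {m}) fun x hx => ?_).trans (Finset.card_singleton m).le
    obtain ⟨w, hw⟩ := mem_walkBall.1 hx
    exact Finset.mem_singleton.2 (SimpleGraph.Walk.eq_of_length_eq_zero (Nat.le_zero.1 hw)).symm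
  | succ k ih =>
    calc (walkBall G (k + 1) m).card
        ≤ 1 + ((G.neighborFinset m).biUnion (walkBall G k)).card :=
          (Finset.card_le_card (walkBall_succ_subset G k m)).trans (Finset.card_union_le _ _)
      _ ≤ 1 + ∑ v ∈ G.neighborFinset m, (K + 1) ^ k :=
          Nat.add_le_add_left (Finset.card_biUnion_le.trans (Finset.sum_le_sum fun v _ => ih v)) 1
      _ = 1 + G.degree m * (K + 1) ^ k := by
          rw [Finset.sum_const, smul_eq_mul, G.card_neighborFinset_eq_degree]
      _ ≤ (K + 1) ^ k + K * (K + 1) ^ k :=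
          Nat.add_le_add (Nat.one_le_pow _ _ K.succ_pos) (Nat.mul_le_mul_right _ (hK m))
      _ = (K + 1) ^ (k + 1) := by ring

theorem mem_of_mem_support_within {G : SimpleGraph V} {S : Set V} {x y : V} (hx : x ∈ S)
    (w : (within G S).Walk x y) {z : V} (hz : z ∈ w.support) : z ∈ S := by
  induction w with
  | nil => exact List.mem_singleton.1 hz ▸ hx
  | cons h w ih => exact (List.mem_cons.1 hz).elim (fun hzx => hzx ▸ hx) (ih h.2.2)

open Classical in
theorem degree_within_le [Fintype V] (G : SimpleGraph V) {S : Set V} {K : ℕ}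
    (hK : ∀ v ∈ S, G.degree v ≤ K) (v : V) : (within G S).degree v ≤ K := by
  by_cases hv : v ∈ S
  · exact (SimpleGraph.degree_le_of_le (within_le G S)).trans (hK v hv)
  · have hisolated : (within G S).neighborFinset v = ∅ :=
      Finset.eq_empty_of_forall_notMem fun w hw =>
        hv (((within G S).mem_neighborFinset v w).1 hw).2.1
    rw [← SimpleGraph.card_neighborFinset_eq_degree, hisolated]
    exact Nat.zero_le K

/-- Every edge of `G` has an end in `low`, vertices outside `low` have no neighbors below them, and
the neighbors outside `low` of a connected part of `low` form a chain. Only the parts of `low` with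
diameter at most `L` matter, because a copy of `H` has few vertices. -/
structure Separated (G : SimpleGraph V) (r : V → V → Prop) (low : Set V) (L : ℕ) : Prop where
  low_or : ∀ u v, G.Adj u v → u ∈ low ∨ v ∈ low
  up : ∀ a x, a ∉ low → G.Adj a x → ¬ r x a
  chain : ∀ x y, x ∈ low → ∀ w : (within G low).Walk x y, w.length ≤ L →
    ∀ a b, a ∉ low → b ∉ low → G.Adj a x → G.Adj b y → r a b ∨ r b a

theorem Separated.anti {G G' : SimpleGraph V} {r : V → V → Prop} {low : Set V} {L : ℕ}
    (h : Separated G r low L) (hle : G' ≤ G) : Separated G' r low L where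
  low_or u v huv := h.low_or u v (hle huv)
  up a x ha hx := h.up a x ha (hle hx)
  chain x y hx w hw a b ha hb hax hby :=
    h.chain x y hx (w.mapLe (within_mono hle subset_rfl)) (by rwa [SimpleGraph.Walk.length_map])
      a b ha hb (hle hax) (hle hby)

open Classical in
/-- The vertices that a vertex `u` outside `low` must not be adjacent to for `low` to be separated:
those below `u`, and those near a vertex of `low` that is below `u`. -/
noncomputable def shadow [Fintype V] (G : SimpleGraph V) (r : V → V → Prop) (low : Set V) (L : ℕ)
    (u : V) : Finset V :=
  strictlyBelow r u ∪ {m ∈ strictlyBelow r u | m ∈ low}.biUnion (walkBall (within G low) L)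

theorem mem_shadow_of_below [Fintype V] (G : SimpleGraph V) {r : V → V → Prop} (low : Set V)
    (L : ℕ) {u v : V} (hvu : r v u) (hne : v ≠ u) : v ∈ shadow G r low L u := by
  classical
  exact Finset.mem_union_left _ (mem_strictlyBelow.2 ⟨hvu, hne⟩)

theorem mem_shadow_of_walk [Fintype V] {G : SimpleGraph V} {r : V → V → Prop} {low : Set V}
    {L : ℕ} {u m v : V} (hu : u ∉ low) (hm : m ∈ low) (hmu : r m u)
    (w : (within G low).Walk m v) (hw : w.length ≤ L) : v ∈ shadow G r low L u := by
  classical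
  have hmu' : m ∈ strictlyBelow r u := mem_strictlyBelow.2 ⟨hmu, fun h => hu (h ▸ hm)⟩
  exact Finset.mem_union_right _ (Finset.mem_biUnion.2
    ⟨m, Finset.mem_filter.2 ⟨hmu', hm⟩, mem_walkBall.2 ⟨w, hw⟩⟩)

theorem shadow_mono [Fintype V] {G G' : SimpleGraph V} (h : G ≤ G') (r : V → V → Prop)
    (low : Set V) (L : ℕ) (u : V) : shadow G r low L u ⊆ shadow G' r low L u := by
  classical
  exact Finset.union_subset_union_right
    (Finset.biUnion_mono fun m _ => walkBall_mono (within_mono h subset_rfl) L m)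

open Classical in
theorem card_shadow_le [Fintype V] {G : SimpleGraph V} {r : V → V → Prop} {low : Set V} {d K : ℕ}
    (hd : ∀ v, treeLevel r v ≤ d) (hK : ∀ v ∈ low, G.degree v ≤ K) (L : ℕ) (u : V) :
    (shadow G r low L u).card ≤ d + d * (K + 1) ^ L := by
  have hbelow : (strictlyBelow r u).card ≤ d := (card_strictlyBelow r u).trans_le (hd u)
  calc (shadow G r low L u).card
      ≤ (strictlyBelow r u).card +
        ∑ m ∈ strictlyBelow r u with m ∈ low, (walkBall (within G low) L m).card :=
        (Finset.card_union_le _ _).trans (Nat.add_le_add_left Finset.card_biUnion_le _)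
    _ ≤ d + ∑ m ∈ strictlyBelow r u with m ∈ low, (K + 1) ^ L :=
        Nat.add_le_add hbelow
          (Finset.sum_le_sum fun m _ => card_walkBall_le (degree_within_le G hK) L m)
    _ ≤ d + d * (K + 1) ^ L := by
        rw [Finset.sum_const, smul_eq_mul]
        exact Nat.add_le_add_left (Nat.mul_le_mul_right _
          ((Finset.card_filter_le _ _).trans hbelow)) d

theorem separated_of_notMem_shadow [Fintype V] {G : SimpleGraph V} {r : V → V → Prop}
    (hr : IsTreeEmbedding G r) {low : Set V} {L : ℕ}
    (hshadow : ∀ u v, u ∉ low → G.Adj u v → v ∉ shadow G r low L u) : Separated G r low L := by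
  classical
  have hup (a x : V) (ha : a ∉ low) (hax : G.Adj a x) : ¬ r x a := fun hxa =>
    hshadow a x ha hax (mem_shadow_of_below G low L hxa hax.ne')
  refine ⟨fun u v huv => ?_, hup, fun x y hx w hw a b ha hb hax hby => ?_⟩
  · by_contra! hcon
    exact (hr.2 u v huv).elim (hup v u hcon.2 huv.symm) (hup u v hcon.1 huv)
  · -- Both `a` and `b` turn out to lie below the least vertex `m` of the walk.
    have hr' : IsTreeEmbedding (within G low) r := ⟨hr.1, fun u v huv => hr.2 u v huv.1⟩
    obtain ⟨m, hm, hmin⟩ := hr'.exists_least_of_walk w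
    have hmlow : m ∈ low := mem_of_mem_support_within hx w hm
    have hbelow (c z : V) (hc : c ∉ low) (hcz : G.Adj c z) (hmz : r m z)
        (p : (within G low).Walk m z) (hp : p.length ≤ L) : r c m :=
      (hr.1.total_below z c m ((hr.2 c z hcz).resolve_right (hup c z hc hcz)) hmz).resolve_right
        fun hmc => hshadow c z hc hcz (mem_shadow_of_walk hc hmlow hmc p hp)
    have ham : r a m := hbelow a x ha hax (hmin x w.start_mem_support) (w.takeUntil m hm).reverse
      (by rw [SimpleGraph.Walk.length_reverse]; exact (w.length_takeUntil_le_length hm).trans hw)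
    have hbm : r b m := hbelow b y hb hby (hmin y w.end_mem_support) (w.dropUntil m hm)
      ((w.length_dropUntil_le_length hm).trans hw)
    exact hr.1.total_below m a b ham hbm

open Classical in
/-- All edges at the vertices with degrees in `(K, K']` are cut off, which leaves the vertices of
degree more than `K'` outside `low`: from these, the edges into their shadows are cut off. -/
theorem exists_separated [Fintype V] {G G₀ : SimpleGraph V} (hle : G₀ ≤ G) {r : V → V → Prop}
    (hr : IsTreeEmbedding G₀ r) {d : ℕ} (hd : ∀ v, treeLevel r v ≤ d) (K K' L : ℕ) :
    ∃ G₁ ≤ G₀, edgeLoss G₀ G₁ ≤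
        ∑ u with K < G.degree u ∧ G.degree u ≤ K', G.degree u +
          (Finset.univ.filter fun u => K' < G.degree u).card * (d + d * (K + 1) ^ L) ∧
      Separated G₁ r {v | G.degree v ≤ K} L ∧
      ∀ u v, G₁.Adj u v → G.degree u ≤ K ∨ K' < G.degree u := by
  set low : Set V := {v | G.degree v ≤ K}
  have hdeg (v : V) : G₀.degree v ≤ G.degree v := SimpleGraph.degree_le_of_le hle
  let N (u : V) : Finset V := if G.degree u ≤ K then ∅
    else if G.degree u ≤ K' then G₀.neighborFinset u else shadow G₀ r low L u
  have hN (u : V) : (N u).card ≤ (if K < G.degree u ∧ G.degree u ≤ K' then G.degree u else 0) +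
      if K' < G.degree u then d + d * (K + 1) ^ L else 0 := by
    have hshadow := card_shadow_le hd (fun v (hv : v ∈ low) => (hdeg v).trans hv) L u
    have hneighbors := (G₀.card_neighborFinset_eq_degree u).trans_le (hdeg u)
    have hempty := Finset.card_empty (α := V)
    simp only [N]
    split_ifs <;> omega
  have hmiddle (u v : V) (huv : (cutOff G₀ N).Adj u v) : G.degree u ≤ K ∨ K' < G.degree u := by
    by_contra! hcon
    refine huv.2.1 ?_
    simp only [N, if_neg (not_le.2 hcon.1), if_pos hcon.2]
    exact (G₀.mem_neighborFinset u v).2 huv.1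
  have hr' : IsTreeEmbedding (cutOff G₀ N) r := ⟨hr.1, fun u v huv => hr.2 u v huv.1⟩
  refine ⟨cutOff G₀ N, cutOff_le G₀ N, ?_,
    separated_of_notMem_shadow hr' fun u v hu huv hv => huv.2.1 ?_, hmiddle⟩
  · calc edgeLoss G₀ (cutOff G₀ N) ≤ ∑ u, (N u).card := edgeLoss_cutOff_le G₀ N
      _ ≤ _ := Finset.sum_le_sum fun u _ => hN u
      _ = _ := by
        rw [Finset.sum_add_distrib, ← Finset.sum_filter, ← Finset.sum_filter, Finset.sum_const,
          smul_eq_mul]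
  · have hu' : ¬ G.degree u ≤ K := hu
    simp only [N, if_neg hu', if_neg (not_le.2 ((hmiddle u v huv).resolve_left hu))]
    exact shadow_mono (cutOff_le G₀ N) r low L u hv

end Separation

/-! ### Copies and their covers by partial maps -/

section Covers

variable {V W : Type*}

/-- `φ` maps `H` onto a (not necessarily induced) copy of `H` in `G`: the unbundled form of
`SimpleGraph.Copy`, used because the graph `G` varies below a fixed map. -/
structure IsCopy (H : SimpleGraph W) (G : SimpleGraph V) (φ : W → V) : Prop where
  inj : Function.Injective φ
  adj : ∀ p q, H.Adj p q → G.Adj (φ p) (φ q)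

theorem IsCopy.mono {H : SimpleGraph W} {G G' : SimpleGraph V} {φ : W → V} (h : IsCopy H G φ)
    (hle : G ≤ G') : IsCopy H G' φ :=
  ⟨h.inj, fun p q hpq => hle (h.adj p q hpq)⟩

theorem free_iff_forall_not_isCopy {H : SimpleGraph W} {G : SimpleGraph V} :
    H.Free G ↔ ∀ φ, ¬ IsCopy H G φ := by
  refine ⟨fun hfree φ hφ => hfree ⟨⟨⟨φ, fun {p q} => hφ.adj p q⟩, hφ.inj⟩⟩, fun h ⟨φ⟩ => ?_⟩
  exact h φ ⟨φ.injective, fun p q hpq => φ.toHom.map_adj hpq⟩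

theorem mem_of_reachable_within {G : SimpleGraph V} {S : Set V} {x y : V}
    (h : (within G S).Reachable x y) (hx : x ∈ S) : y ∈ S :=
  h.elim fun w => mem_of_mem_support_within hx w w.end_mem_support

theorem reachable_within_of_adj {G : SimpleGraph V} {S : Set V} {q x y : V} (hq : q ∈ S)
    (h : (within G S).Reachable q x) (hxy : G.Adj x y) (hy : y ∈ S) :
    (within G S).Reachable q y :=
  h.trans (SimpleGraph.Adj.reachable ⟨hxy, mem_of_reachable_within h hq, hy⟩)

theorem IsCopy.reroute {H : SimpleGraph W} {G : SimpleGraph V} {φ φ' : W → V} (hφ : IsCopy H G φ)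
    (hφ' : IsCopy H G φ') {U : Set W} (hU : ∀ u ∈ U, φ' u = φ u)
    (hdisj : ∀ w ∉ U, ∀ w' ∉ U, φ' w ≠ φ w') {q : W} (hq : q ∉ U) :
    ∃ ψ, IsCopy H G ψ ∧ ψ q = φ' q ∧ ∀ x, ¬ (within H Uᶜ).Reachable q x → ψ x = φ x := by
  classical
  have hcross (x y : W) (hx : (within H Uᶜ).Reachable q x)
      (hy : ¬ (within H Uᶜ).Reachable q y) : φ' x ≠ φ y := fun h => by
    by_cases hyU : y ∈ U
    · exact hy (hφ'.inj (h.trans (hU y hyU).symm) ▸ hx)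
    · exact hdisj x (mem_of_reachable_within hx hq) y hyU h
  have hboundary (x y : W) (hx : (within H Uᶜ).Reachable q x)
      (hy : ¬ (within H Uᶜ).Reachable q y) (hxy : H.Adj x y) : φ' y = φ y := by
    by_contra hne
    exact hy (reachable_within_of_adj hq hx hxy fun hyU => hne (hU y hyU))
  refine ⟨fun x => if (within H Uᶜ).Reachable q x then φ' x else φ x,
    ⟨fun x y hxy => ?_, fun x y hxy => ?_⟩, if_pos (SimpleGraph.Reachable.refl q), fun x hx =>
      if_neg hx⟩
  · split_ifs at hxy with hx hy hy
    · exact hφ'.inj hxy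
    · exact absurd hxy (hcross x y hx hy)
    · exact absurd hxy.symm (hcross y x hy hx)
    · exact hφ.inj hxy
  · split_ifs with hx hy hy
    · exact hφ'.adj x y hxy
    · exact hboundary x y hx hy hxy ▸ hφ'.adj x y hxy
    · exact hboundary y x hy hx hxy.symm ▸ hφ'.adj x y hxy
    · exact hφ.adj x y hxy

/-- The total map `φ` extends the partial map `σ`, and `σ` is defined wherever `φ` takes a value
in `B`. -/
structure Represents (B : Set V) (σ : W → Option V) (φ : W → V) : Prop where
  extend : ∀ w v, σ w = some v → φ w = v
  defined : ∀ w, φ w ∈ B → σ w ≠ none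

open Classical in
theorem Represents.update {B : Set V} {σ : W → Option V} {φ : W → V} (h : Represents B σ φ)
    (w : W) : Represents B (Function.update σ w (some (φ w))) φ where
  extend x v hx := by
    rcases eq_or_ne x w with rfl | hne
    · exact Option.some.inj ((Function.update_self x _ σ).symm.trans hx)
    · exact h.extend x v ((Function.update_of_ne hne _ σ).symm.trans hx)
  defined x hx := by
    rcases eq_or_ne x w with rfl | hne
    · rw [Function.update_self]
      exact Option.some_ne_none _
    · rw [Function.update_of_ne hne]
      exact h.defined x hx

open Classical in
theorem represents_restrict (B : Set V) (φ : W → V) :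
    Represents B (fun w => if φ w ∈ B then some (φ w) else none) φ where
  extend w v hv := (Option.ite_none_right_eq_some.1 hv).2 |> Option.some.inj
  defined w hw := by
    rw [if_pos hw]
    exact Option.some_ne_none _

/-- Every map in `Φ` is represented by a partial map in `P`, and these are not defined at `q`. -/
structure IsCover (B : Set V) (q : W) (Φ : Set (W → V)) (P : Finset (W → Option V)) : Prop where
  none_at : ∀ σ ∈ P, σ q = none
  exists_represents : ∀ φ ∈ Φ, ∃ σ ∈ P, Represents B σ φ

theorem IsCover.mono {B : Set V} {q : W} {Φ Φ' : Set (W → V)} {P : Finset (W → Option V)}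
    (hP : IsCover B q Φ' P) (h : Φ ⊆ Φ') : IsCover B q Φ P :=
  ⟨hP.none_at, fun φ hφ => hP.exists_represents φ (h hφ)⟩

variable [Fintype W]

open Classical in
/-- The set on which a partial map is not defined. -/
noncomputable def undef (σ : W → Option V) : Finset W :=
  {w | σ w = none}

theorem mem_undef {σ : W → Option V} {w : W} : w ∈ undef σ ↔ σ w = none := by
  simp only [undef, Finset.mem_filter_univ]

open Classical in
theorem undef_update_some (σ : W → Option V) (w : W) (v : V) :
    undef (Function.update σ w (some v)) = (undef σ).erase w := by
  ext x
  rw [Finset.mem_erase, mem_undef, mem_undef]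
  rcases eq_or_ne x w with rfl | hne
  · simp only [Function.update_self, reduceCtorEq, ne_eq, not_true_eq_false, false_and]
  · simp only [Function.update_of_ne hne, ne_eq, hne, not_false_eq_true, true_and]

/-- The total weight of a set of partial maps. The base is so large that a partial map outweighs
its `refinements` taken together. -/
noncomputable def coverWeight (P : Finset (W → Option V)) : ℕ :=
  ∑ σ ∈ P, (Fintype.card W ^ 2 + 1) ^ (undef σ).card

/-- The minimal weight of a cover. -/
noncomputable def coverNumber (B : Set V) (q : W) (Φ : Set (W → V)) : ℕ :=
  sInf {m | ∃ P, IsCover B q Φ P ∧ coverWeight P = m}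

theorem IsCover.coverNumber_le {B : Set V} {q : W} {Φ : Set (W → V)}
    {P : Finset (W → Option V)} (h : IsCover B q Φ P) : coverNumber B q Φ ≤ coverWeight P :=
  Nat.sInf_le ⟨P, h, rfl⟩

theorem coverWeight_le_card_mul (P : Finset (W → Option V)) :
    coverWeight P ≤ P.card * (Fintype.card W ^ 2 + 1) ^ Fintype.card W :=
  Finset.sum_le_card_nsmul _ _ _ fun σ _ =>
    Nat.pow_le_pow_right (Nat.succ_pos _) (Finset.card_le_univ (undef σ))

theorem exists_isCover [Finite V] (B : Set V) {q : W} {Φ : Set (W → V)}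
    (hΦ : ∀ φ ∈ Φ, φ q ∉ B) :
    ∃ P, IsCover B q Φ P ∧ coverWeight P ≤
      (B.ncard + 1) ^ Fintype.card W * (Fintype.card W ^ 2 + 1) ^ Fintype.card W := by
  classical
  have := Fintype.ofFinite V
  let choices (w : W) : Finset (Option V) := if w = q then {none} else Finset.insertNone B.toFinset
  have hcard (w : W) : (choices w).card ≤ B.ncard + 1 := by
    simp only [choices]
    split_ifs
    · exact (Finset.card_singleton _).trans_le (Nat.le_add_left 1 _)
    · rw [Finset.card_insertNone, ← Set.ncard_eq_toFinset_card']
  refine ⟨Fintype.piFinset choices, ⟨fun σ hσ => ?_, fun φ hφ => ?_⟩, ?_⟩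
  · simpa only [choices, if_pos, Finset.mem_singleton] using Fintype.mem_piFinset.1 hσ q
  · refine ⟨_, Fintype.mem_piFinset.2 fun w => ?_, represents_restrict B φ⟩
    simp only [choices]
    split_ifs with hwq hw hw
    · exact absurd (hwq ▸ hw) (hΦ φ hφ)
    · exact Finset.mem_singleton_self none
    · exact Finset.some_mem_insertNone.2 (Set.mem_toFinset.2 hw)
    · exact Finset.none_mem_insertNone
  · refine (coverWeight_le_card_mul _).trans (Nat.mul_le_mul_right _ ?_)
    rw [Fintype.card_piFinset, Fintype.card]
    exact Finset.prod_le_pow_card _ _ _ fun w _ => hcard w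

theorem coverNumber_le [Finite V] (B : Set V) {q : W} {Φ : Set (W → V)} (hΦ : ∀ φ ∈ Φ, φ q ∉ B) :
    coverNumber B q Φ ≤
      (B.ncard + 1) ^ Fintype.card W * (Fintype.card W ^ 2 + 1) ^ Fintype.card W :=
  let ⟨_, hP, hweight⟩ := exists_isCover B hΦ
  hP.coverNumber_le.trans hweight

theorem exists_isCover_coverWeight_eq [Finite V] (B : Set V) {q : W} {Φ : Set (W → V)}
    (hΦ : ∀ φ ∈ Φ, φ q ∉ B) : ∃ P, IsCover B q Φ P ∧ coverWeight P = coverNumber B q Φ :=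
  let ⟨P, hP, _⟩ := exists_isCover B hΦ
  Nat.sInf_mem (s := {m | ∃ P, IsCover B q Φ P ∧ coverWeight P = m}) ⟨_, P, hP, rfl⟩

theorem coverNumber_mono [Finite V] (B : Set V) {q : W} {Φ Φ' : Set (W → V)} (h : Φ ⊆ Φ')
    (hΦ' : ∀ φ ∈ Φ', φ q ∉ B) : coverNumber B q Φ ≤ coverNumber B q Φ' :=
  let ⟨_, hP, hweight⟩ := exists_isCover_coverWeight_eq B hΦ'
  (hP.mono h).coverNumber_le.trans_eq hweight

open Classical in
theorem coverWeight_union_le (P Q : Finset (W → Option V)) :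
    coverWeight (P ∪ Q) ≤ coverWeight P + coverWeight Q := by
  rw [coverWeight, coverWeight, coverWeight, ← Finset.sum_union_inter]
  exact Nat.le_add_right _ _

open Classical in
/-- The extensions of the partial map `σ` by one more value in `Z`, at a point other than `q`. -/
noncomputable def refinements (σ : W → Option V) (q : W) (Z : Finset V) : Finset (W → Option V) :=
  ((undef σ).erase q ×ˢ Z).image fun p => Function.update σ p.1 (some p.2)

theorem apply_eq_none_of_mem_refinements {σ τ : W → Option V} {q : W} {Z : Finset V}
    (hq : σ q = none) (hτ : τ ∈ refinements σ q Z) : τ q = none := by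
  classical
  obtain ⟨⟨w, v⟩, hwv, rfl⟩ := Finset.mem_image.1 hτ
  have hwq : w ≠ q := Finset.ne_of_mem_erase (Finset.mem_product.1 hwv).1
  exact (Function.update_of_ne hwq.symm _ σ).trans hq

theorem card_undef_lt_of_mem_refinements {σ τ : W → Option V} {q : W} {Z : Finset V}
    (hτ : τ ∈ refinements σ q Z) : (undef τ).card < (undef σ).card := by
  classical
  obtain ⟨⟨w, v⟩, hwv, rfl⟩ := Finset.mem_image.1 hτ
  rw [undef_update_some]
  exact Finset.card_erase_lt_of_mem (Finset.mem_of_mem_erase (Finset.mem_product.1 hwv).1)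

theorem coverWeight_refinements_lt {σ : W → Option V} {q : W} (hq : σ q = none) {Z : Finset V}
    (hZ : Z.card ≤ Fintype.card W) :
    coverWeight (refinements σ q Z) < (Fintype.card W ^ 2 + 1) ^ (undef σ).card := by
  classical
  obtain ⟨k, hk⟩ : ∃ k, (undef σ).card = k + 1 :=
    Nat.exists_eq_succ_of_ne_zero (Finset.card_ne_zero_of_mem (mem_undef.2 hq))
  have hcard : (refinements σ q Z).card ≤ Fintype.card W ^ 2 := by
    refine Finset.card_image_le.trans ?_
    rw [Finset.card_product, sq]
    exact Nat.mul_le_mul (Finset.card_le_univ _) hZ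
  calc coverWeight (refinements σ q Z)
      ≤ (refinements σ q Z).card * (Fintype.card W ^ 2 + 1) ^ k :=
        Finset.sum_le_card_nsmul _ _ _ fun τ hτ => Nat.pow_le_pow_right (Nat.succ_pos _)
          (Nat.le_of_lt_succ ((card_undef_lt_of_mem_refinements hτ).trans_eq hk))
    _ ≤ Fintype.card W ^ 2 * (Fintype.card W ^ 2 + 1) ^ k := Nat.mul_le_mul_right _ hcard
    _ < (Fintype.card W ^ 2 + 1) * (Fintype.card W ^ 2 + 1) ^ k :=
        (Nat.mul_lt_mul_right (Nat.pow_pos (Nat.succ_pos _))).2 (Nat.lt_succ_self _)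
    _ = (Fintype.card W ^ 2 + 1) ^ (undef σ).card := by rw [hk, pow_succ' _ k]

/-- The member `σ` of a cover can be replaced by its refinements, if all maps of the smaller family
`Φ'` that it represents meet the small set `Z`. -/
theorem coverNumber_lt_of_refine {B : Set V} {q : W} {Φ Φ' : Set (W → V)} (hsub : Φ' ⊆ Φ)
    {P : Finset (W → Option V)} (hP : IsCover B q Φ P) {σ : W → Option V} (hσ : σ ∈ P)
    {Z : Finset V} (hZ : Z.card ≤ Fintype.card W)
    (hhit : ∀ φ ∈ Φ', Represents B σ φ → ∃ w, σ w = none ∧ w ≠ q ∧ φ w ∈ Z) :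
    coverNumber B q Φ' < coverWeight P := by
  classical
  have hcover : IsCover B q Φ' (P.erase σ ∪ refinements σ q Z) := by
    refine ⟨fun τ hτ => ?_, fun φ hφ => ?_⟩
    · rcases Finset.mem_union.1 hτ with hτ | hτ
      · exact hP.none_at τ (Finset.mem_of_mem_erase hτ)
      · exact apply_eq_none_of_mem_refinements (hP.none_at σ hσ) hτ
    · obtain ⟨τ, hτ, hτφ⟩ := hP.exists_represents φ (hsub hφ)
      rcases eq_or_ne τ σ with rfl | hne
      · obtain ⟨w, hw, hwq, hwZ⟩ := hhit φ hφ hτφ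
        exact ⟨_, Finset.mem_union_right _ (Finset.mem_image.2 ⟨(w, φ w), Finset.mem_product.2
          ⟨Finset.mem_erase.2 ⟨hwq, mem_undef.2 hw⟩, hwZ⟩, rfl⟩), hτφ.update w⟩
      · exact ⟨τ, Finset.mem_union_left _ (Finset.mem_erase.2 ⟨hne, hτ⟩), hτφ⟩
  calc coverNumber B q Φ' ≤ coverWeight (P.erase σ ∪ refinements σ q Z) := hcover.coverNumber_le
    _ ≤ coverWeight (P.erase σ) + coverWeight (refinements σ q Z) := coverWeight_union_le _ _
    _ < coverWeight (P.erase σ) + (Fintype.card W ^ 2 + 1) ^ (undef σ).card :=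
      Nat.add_lt_add_left (coverWeight_refinements_lt (hP.none_at σ hσ) hZ) _
    _ = coverWeight P := Finset.sum_erase_add _ _ hσ

end Covers

/-! ### Deleting edges until every vertex has many alternatives -/

section Alternatives

variable {V W : Type*}

/-- The maps onto copies of `H` in `G` for which the image of `q` lies in `T`, but not in `B`. -/
def placements (H : SimpleGraph W) (G : SimpleGraph V) (B T : Set V) (q : W) : Set (W → V) :=
  {φ | IsCopy H G φ ∧ φ q ∈ T ∧ φ q ∉ B}

theorem placements_mono (H : SimpleGraph W) {G G' : SimpleGraph V} (hG : G ≤ G') (B : Set V)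
    {T T' : Set V} (hT : T ⊆ T') (q : W) : placements H G B T q ⊆ placements H G' B T' q :=
  fun _ hφ => ⟨hφ.1.mono hG, hT hφ.2.1, hφ.2.2⟩

/-- The possible images of `q` if `φ` is changed only on the component of `q` in the part of `H`
that `φ` does not map into `B`. -/
def alternatives (H : SimpleGraph W) (G : SimpleGraph V) (B T : Set V) (q : W) (φ : W → V) :
    Set V :=
  {y | ∃ φ' ∈ placements H G B T q, φ' q = y ∧
    ∀ x, ¬ (within H (φ ⁻¹' B)ᶜ).Reachable q x → φ' x = φ x}

/-- If all alternatives for `φ` are excluded from `T'`, then each map in the smaller family that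
agrees with `φ` where `σ` is defined must meet the image of the remaining vertices under `φ`:
otherwise `φ` could be rerouted along it. -/
theorem coverNumber_placements_lt [Fintype W] {H : SimpleGraph W} {G G' : SimpleGraph V}
    (hG : G' ≤ G) {B T T' : Set V} (hT : T' ⊆ T) {q : W} {P : Finset (W → Option V)}
    (hP : IsCover B q (placements H G B T q) P) {φ : W → V} (hφ : φ ∈ placements H G B T q)
    (halt : Disjoint (alternatives H G B T q φ) T') (himage : Disjoint (Set.range φ) T') :
    coverNumber B q (placements H G' B T' q) < coverWeight P := by
  classical
  obtain ⟨σ, hσ, hσφ⟩ := hP.exists_represents φ hφ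
  have hsub := placements_mono H hG B hT q
  refine coverNumber_lt_of_refine hsub hP hσ (Z := (undef σ).image φ)
    (Finset.card_image_le.trans (Finset.card_le_univ _)) fun φ' hφ' hσφ' => ?_
  by_contra! hmiss
  have hdisj (w : W) (hw : w ∈ undef σ) (w' : W) (hw' : w' ∈ undef σ) : φ' w ≠ φ w' := by
    rcases eq_or_ne w q with rfl | hwq
    · exact fun h => Set.disjoint_left.1 himage ⟨w', h.symm⟩ hφ'.2.1
    · exact fun h => hmiss w (mem_undef.1 hw) hwq (h ▸ Finset.mem_image_of_mem φ hw')
  have hagree (u : W) (hu : u ∈ {w | σ w ≠ none}) : φ' u = φ u := by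
    obtain ⟨v, hv⟩ := Option.ne_none_iff_exists'.1 hu
    rw [hσφ'.extend u v hv, hσφ.extend u v hv]
  obtain ⟨ψ, hψ, hψq, hfix⟩ := hφ.1.reroute (hsub hφ').1 hagree
    (fun w hw w' hw' => hdisj w (mem_undef.2 (not_not.1 hw)) w' (mem_undef.2 (not_not.1 hw')))
    (not_not.2 (hP.none_at σ hσ))
  have hcomponent : within H {w | σ w ≠ none}ᶜ ≤ within H (φ ⁻¹' B)ᶜ :=
    within_mono le_rfl (Set.compl_subset_compl.2 hσφ.defined)
  have hplaced : ψ ∈ placements H G B T q := ⟨hψ, hψq ▸ (hsub hφ').2⟩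
  exact Set.disjoint_left.1 halt
    ⟨ψ, hplaced, hψq, fun x hx => hfix x fun h => hx (h.mono hcomponent)⟩ hφ'.2.1

/-- The vertices below `a`, including `a`; here `none` is a virtual root below all vertices. -/
def below (r : V → V → Prop) : Option V → Set V
  | none => ∅
  | some a => {u | r u a}

/-- The vertices of `low` adjacent to `a`; the virtual root `none` is regarded as adjacent to all
non-isolated vertices. -/
def attached (G : SimpleGraph V) (low : Set V) : Option V → Set V
  | none => {y | y ∈ low ∧ ∃ z, G.Adj y z}
  | some a => {y | y ∈ low ∧ G.Adj a y}

theorem attached_mono {G G' : SimpleGraph V} (h : G ≤ G') (low : Set V) (a : Option V) :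
    attached G low a ⊆ attached G' low a := by
  cases a with
  | none => exact fun y ⟨hy, z, hz⟩ => ⟨hy, z, h hz⟩
  | some a => exact fun y ⟨hy, ha⟩ => ⟨hy, h ha⟩

/-- The maximal number of edges attaching a vertex of `low` to `a`, if the vertices of `low` have
degree at most `K`. -/
def attachCost (K : ℕ) : Option V → ℕ
  | none => K
  | some _ => 1

variable [Fintype V]

open Classical in
theorem exists_disjoint_attached {G : SimpleGraph V} {low : Set V} {K : ℕ}
    (hK : ∀ v ∈ low, G.degree v ≤ K) (a : Option V) (X : Set V) :
    ∃ G' ≤ G, edgeLoss G G' ≤ X.ncard * attachCost K a ∧ Disjoint X (attached G' low a) := by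
  let attachments (x : V) : Finset V := match a with
    | none => if x ∈ low then G.neighborFinset x else ∅
    | some b => {b}
  have hcard (x : V) : (attachments x).card ≤ attachCost K a := by
    cases a with
    | none =>
      simp only [attachments, attachCost]
      split_ifs with hx
      · exact (G.card_neighborFinset_eq_degree x).trans_le (hK x hx)
      · exact Nat.zero_le K
    | some b => exact (Finset.card_singleton b).le
  let N (x : V) : Finset V := if x ∈ X then attachments x else ∅
  have hcut (x y : V) (hx : x ∈ X) (hy : y ∈ attachments x) : ¬ (cutOff G N).Adj x y :=
    fun h => h.2.1 (by simpa only [N, if_pos hx])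
  refine ⟨cutOff G N, cutOff_le G N, ?_, Set.disjoint_left.2 fun x hx hax => ?_⟩
  · calc edgeLoss G (cutOff G N) ≤ ∑ x, (N x).card := edgeLoss_cutOff_le G N
      _ = ∑ x ∈ X.toFinset, (attachments x).card := by
        simp only [N, apply_ite Finset.card, Finset.card_empty, ← Finset.sum_filter,
          Set.filter_mem_univ_eq_toFinset]
      _ ≤ X.toFinset.card * attachCost K a := Finset.sum_le_card_nsmul _ _ _ fun x _ => hcard x
      _ = X.ncard * attachCost K a := by rw [Set.ncard_eq_toFinset_card']
  · cases a with
    | none =>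
      obtain ⟨hlow, z, hz⟩ := hax
      refine hcut x z hx ?_ hz
      simpa only [attachments, if_pos hlow, SimpleGraph.mem_neighborFinset] using hz.1
    | some b => exact hcut x b hx (Finset.mem_singleton_self b) hax.2.symm

variable [Fintype W]

/-- The cover number of the copies of `H` in which `q` is attached to `a`: it decreases whenever a
vertex with few alternatives is detached from `a`. -/
noncomputable def attachmentNumber (H : SimpleGraph W) (G : SimpleGraph V) (r : V → V → Prop)
    (low : Set V) (a : Option V) (q : W) : ℕ :=
  coverNumber (below r a) q (placements H G (below r a) (attached G low a) q)

omit [Fintype V] in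
theorem attachmentNumber_mono [Finite V] (H : SimpleGraph W) {G G' : SimpleGraph V} (h : G ≤ G')
    (r : V → V → Prop) (low : Set V) (a : Option V) (q : W) :
    attachmentNumber H G r low a q ≤ attachmentNumber H G' r low a q :=
  coverNumber_mono _ (placements_mono H h _ (attached_mono h low a) q) fun _ hφ => hφ.2.2

open Classical in
theorem exists_attachmentNumber_lt {H : SimpleGraph W} {G : SimpleGraph V}
    {r : V → V → Prop} {low : Set V} {K : ℕ} (hK : ∀ v ∈ low, G.degree v ≤ K)
    {a : Option V} {q : W} {φ : W → V}
    (hφ : φ ∈ placements H G (below r a) (attached G low a) q) :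
    ∃ G' ≤ G, edgeLoss G G' ≤
        ((alternatives H G (below r a) (attached G low a) q φ).ncard + Fintype.card W) *
          attachCost K a ∧
      attachmentNumber H G' r low a q < attachmentNumber H G r low a q := by
  set X : Set V := alternatives H G (below r a) (attached G low a) q φ ∪ Set.range φ
  obtain ⟨G', hle, hloss, hX⟩ := exists_disjoint_attached hK a X
  have hrange : (Set.range φ).ncard ≤ Fintype.card W := by
    rw [← Nat.card_eq_fintype_card]
    exact Finite.card_range_le φ
  refine ⟨G', hle, hloss.trans (Nat.mul_le_mul_right _ ?_), ?_⟩
  · exact (Set.ncard_union_le _ _).trans (Nat.add_le_add_left hrange _)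
  · obtain ⟨P, hP, hweight⟩ := exists_isCover_coverWeight_eq (below r a)
      (Φ := placements H G (below r a) (attached G low a) q) fun _ hφ => hφ.2.2
    rw [attachmentNumber, attachmentNumber, ← hweight]
    exact coverNumber_placements_lt hle (attached_mono hle low a) hP hφ
      (hX.mono_left Set.subset_union_left) (hX.mono_left Set.subset_union_right)

end Alternatives

/-- If each violated condition can be paid for by the decrease of its own potential, a minimal graph
among those whose edge loss has been paid for satisfies all conditions. -/
theorem exists_le_of_potential {V ι : Type*} [Finite V] {G : SimpleGraph V} {A : Finset ι}
    {good : SimpleGraph V → ι → Prop} {ρ : SimpleGraph V → ι → ℕ} {cost : ι → ℝ}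
    (hcost : ∀ i, 0 ≤ cost i) (hρ : ∀ G₁ G₂, G₁ ≤ G₂ → ∀ i, ρ G₁ i ≤ ρ G₂ i)
    (hstep : ∀ G₁ ≤ G, ∀ i ∈ A, ¬ good G₁ i →
      ∃ G₂ ≤ G₁, (edgeLoss G₁ G₂ : ℝ) ≤ cost i ∧ ρ G₂ i < ρ G₁ i) :
    ∃ G' ≤ G, (edgeLoss G G' : ℝ) ≤ ∑ i ∈ A, cost i * ρ G i ∧ ∀ i ∈ A, good G' i := by
  let paid : Set (SimpleGraph V) :=
    {G' | G' ≤ G ∧ (edgeLoss G G' : ℝ) + ∑ i ∈ A, cost i * ρ G' i ≤ ∑ i ∈ A, cost i * ρ G i}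
  have hG : G ∈ paid := ⟨le_rfl, by rw [edgeLoss_self, Nat.cast_zero, zero_add]⟩
  obtain ⟨G', ⟨hle, hpaid⟩, hmin⟩ := paid.toFinite.exists_minimal ⟨G, hG⟩
  have hnonneg : 0 ≤ ∑ i ∈ A, cost i * (ρ G' i : ℝ) :=
    Finset.sum_nonneg fun i _ => mul_nonneg (hcost i) (Nat.cast_nonneg _)
  refine ⟨G', hle, by linarith, fun i hi => by_contra fun hbad => ?_⟩
  obtain ⟨G₂, hle₂, hloss, hlt⟩ := hstep G' hle i hi hbad
  have hdecrease : cost i ≤ ∑ j ∈ A, (cost j * (ρ G' j : ℝ) - cost j * ρ G₂ j) := by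
    have hterm (j : ι) : 0 ≤ cost j * (ρ G' j : ℝ) - cost j * ρ G₂ j := by
      rw [← mul_sub]
      exact mul_nonneg (hcost j) (sub_nonneg.2 (Nat.cast_le.2 (hρ _ _ hle₂ j)))
    refine le_trans ?_ (Finset.single_le_sum (fun j _ => hterm j) hi)
    rw [← mul_sub]
    have hone : (ρ G₂ i : ℝ) + 1 ≤ ρ G' i := by exact_mod_cast hlt
    exact le_mul_of_one_le_right (hcost i) (le_sub_iff_add_le'.2 hone)
  rw [Finset.sum_sub_distrib] at hdecrease
  have htriangle : (edgeLoss G G₂ : ℝ) ≤ edgeLoss G G' + edgeLoss G' G₂ := by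
    exact_mod_cast edgeLoss_triangle G G' G₂
  have heq : G' ≤ G₂ := hmin ⟨hle₂.trans hle, by linarith⟩ hle₂
  exact hlt.not_ge (hρ _ _ heq i)

open Classical in
theorem exists_many_alternatives {V W : Type*} [Fintype V] [Fintype W] (H : SimpleGraph W)
    {G : SimpleGraph V} (r : V → V → Prop) {low : Set V} {K : ℕ} (hK : ∀ v ∈ low, G.degree v ≤ K)
    (A : Finset (Option V)) {τ : Option V → ℝ} (hτ : ∀ a, 0 ≤ τ a) :
    ∃ G' ≤ G, (edgeLoss G G' : ℝ) ≤ ∑ a ∈ A, ∑ q : W,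
        (τ a + Fintype.card W) * attachCost K a * attachmentNumber H G r low a q ∧
      ∀ a ∈ A, ∀ q, ∀ φ ∈ placements H G' (below r a) (attached G' low a) q,
        τ a ≤ (alternatives H G' (below r a) (attached G' low a) q φ).ncard := by
  let good (G' : SimpleGraph V) (i : Option V × W) : Prop :=
    ∀ φ ∈ placements H G' (below r i.1) (attached G' low i.1) i.2,
      τ i.1 ≤ (alternatives H G' (below r i.1) (attached G' low i.1) i.2 φ).ncard
  have hstep (G₁ : SimpleGraph V) (hG₁ : G₁ ≤ G) (i : Option V × W)
      (_ : i ∈ A ×ˢ (Finset.univ : Finset W)) (hbad : ¬ good G₁ i) :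
      ∃ G₂ ≤ G₁, (edgeLoss G₁ G₂ : ℝ) ≤ (τ i.1 + Fintype.card W) * attachCost K i.1 ∧
        attachmentNumber H G₂ r low i.1 i.2 < attachmentNumber H G₁ r low i.1 i.2 := by
    simp only [good, not_forall, not_le] at hbad
    obtain ⟨φ, hφ, hlt⟩ := hbad
    obtain ⟨G₂, hle, hloss, hdecrease⟩ := exists_attachmentNumber_lt
      (fun v hv => (SimpleGraph.degree_le_of_le hG₁).trans (hK v hv)) hφ
    refine ⟨G₂, hle, (Nat.cast_le.2 hloss).trans ?_, hdecrease⟩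
    push_cast
    gcongr
  obtain ⟨G', hle, hloss, hgood⟩ := exists_le_of_potential
    (fun i : Option V × W => mul_nonneg (add_nonneg (hτ i.1) (Nat.cast_nonneg _))
      (Nat.cast_nonneg _))
    (fun _ _ h i => attachmentNumber_mono H h r low i.1 i.2) hstep
  rw [Finset.sum_product] at hloss
  exact ⟨G', hle, hloss, fun a ha q => hgood (a, q) (Finset.mk_mem_product ha (Finset.mem_univ q))⟩

/-! ### Cleaning a sparse graph -/

section Thresholds

theorem exists_mul_sum_gap_le {V : Type*} [Fintype V] (f : V → ℕ) {κ : ℕ → ℕ} (hκ : Monotone κ)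
    {I : ℕ} (hI : 0 < I) :
    ∃ i < I, I * ∑ u with κ i < f u ∧ f u ≤ κ (i + 1), f u ≤ ∑ u, f u := by
  classical
  let gap (i : ℕ) : Finset V := {u | κ i < f u ∧ f u ≤ κ (i + 1)}
  have hdisj : (Finset.range I : Set ℕ).PairwiseDisjoint gap := fun i _ j _ hij =>
    Finset.disjoint_filter.2 fun u _ hi hj =>
      Set.disjoint_left.1 (hκ.pairwise_disjoint_on_Ioc_succ hij) hi hj
  have hsum : ∑ i ∈ Finset.range I, ∑ u ∈ gap i, f u ≤ ∑ u, f u := by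
    rw [← Finset.sum_biUnion hdisj]
    exact Finset.sum_le_sum_of_subset (Finset.subset_univ _)
  obtain ⟨i, hi, hmin⟩ := Finset.exists_min_image (Finset.range I) (fun i => ∑ u ∈ gap i, f u)
    ⟨0, Finset.mem_range.2 hI⟩
  refine ⟨i, Finset.mem_range.1 hi, le_trans ?_ hsum⟩
  simpa only [Finset.card_range, smul_eq_mul] using Finset.card_nsmul_le_sum _ _ _ hmin

theorem card_filter_lt_mul_le_sum {V : Type*} [Fintype V] (f : V → ℕ) (K : ℕ) :
    ({u | K < f u} : Finset V).card * K ≤ ∑ u, f u :=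
  calc ({u | K < f u} : Finset V).card * K ≤ ∑ u with K < f u, f u :=
        Finset.card_nsmul_le_sum _ _ _ fun _ hu => (Finset.mem_filter.1 hu).2.le
    _ ≤ ∑ u, f u := Finset.sum_le_sum_of_subset (Finset.filter_subset _ _)

/-- Take thresholds growing so fast that Markov's inequality handles the values above the next one;
by pigeonhole, few values lie between some two consecutive thresholds. -/
theorem exists_thresholds (X : ℕ → ℕ) (c : ℕ) {δ : ℝ} (hδ : 0 < δ) :
    ∃ κ : ℕ, ∀ (V : Type*) [Fintype V] (f : V → ℕ), ∑ v, f v ≤ c * Fintype.card V →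
      ∃ K ≤ κ, ∃ K', ∑ u with K < f u ∧ f u ≤ K', (f u : ℝ) ≤ δ * Fintype.card V ∧
        (({u | K' < f u} : Finset V).card * X K : ℝ) ≤ δ * Fintype.card V := by
  let next (K : ℕ) : ℕ := max (K + 1) ⌈c * X K / δ⌉₊
  let κ (i : ℕ) : ℕ := next^[i] 0
  have hnext (i : ℕ) : κ (i + 1) = next (κ i) := Function.iterate_succ_apply' _ _ _
  have hκ : Monotone κ := monotone_nat_of_le_succ fun i => by
    rw [hnext]
    exact (Nat.le_succ _).trans (le_max_left _ _)
  obtain ⟨I, hI⟩ := exists_nat_gt ((c : ℝ) / δ)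
  have hIpos : (0 : ℝ) < I := (by positivity : (0 : ℝ) ≤ c / δ).trans_lt hI
  rw [div_lt_iff₀ hδ] at hI
  refine ⟨κ I, fun V _ f hf => ?_⟩
  obtain ⟨i, hiI, hgap⟩ := exists_mul_sum_gap_le f hκ (Nat.cast_pos.1 hIpos)
  refine ⟨κ i, hκ hiI.le, κ (i + 1), ?_, ?_⟩
  · refine le_of_mul_le_mul_left ?_ hIpos
    calc (I : ℝ) * ∑ u with κ i < f u ∧ f u ≤ κ (i + 1), (f u : ℝ)
        ≤ c * Fintype.card V := by exact_mod_cast hgap.trans hf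
      _ ≤ I * δ * Fintype.card V := by gcongr
      _ = I * (δ * Fintype.card V) := mul_assoc _ _ _
  · have hpos : (0 : ℝ) < κ (i + 1) := by
      rw [hnext]
      exact Nat.cast_pos.2 ((Nat.succ_pos _).trans_le (le_max_left _ _))
    have hX : (c * X (κ i) : ℝ) ≤ κ (i + 1) * δ := by
      rw [← div_le_iff₀ hδ, hnext]
      exact (Nat.le_ceil _).trans (Nat.cast_le.2 (le_max_right _ _))
    have hmarkov : (({u | κ (i + 1) < f u} : Finset V).card * κ (i + 1) : ℝ) ≤
        c * Fintype.card V := by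
      exact_mod_cast (card_filter_lt_mul_le_sum f (κ (i + 1))).trans hf
    refine le_of_mul_le_mul_right ?_ hpos
    calc _ = ({u | κ (i + 1) < f u} : Finset V).card * κ (i + 1) * (X (κ i) : ℝ) :=
          mul_right_comm _ _ _
      _ ≤ c * Fintype.card V * X (κ i) := by gcongr
      _ = c * X (κ i) * Fintype.card V := mul_right_comm _ _ _
      _ ≤ κ (i + 1) * δ * Fintype.card V := by gcongr
      _ = δ * Fintype.card V * κ (i + 1) := by ring

end Thresholds

section Cleaning

theorem ncard_below_le {V : Type*} [Finite V] {r : V → V → Prop} {d : ℕ}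
    (hd : ∀ v, treeLevel r v ≤ d) (a : Option V) : (below r a).ncard ≤ d + 1 := by
  cases a with
  | none => exact Set.ncard_empty V ▸ Nat.zero_le _
  | some a =>
    have hsub : below r (some a) ⊆ insert a {u | r u a ∧ u ≠ a} := fun u hu =>
      or_iff_not_imp_left.2 fun hua => ⟨hu, hua⟩
    calc (below r (some a)).ncard ≤ (insert a {u | r u a ∧ u ≠ a}).ncard :=
          Set.ncard_le_ncard hsub
      _ ≤ treeLevel r a + 1 := Set.ncard_insert_le _ _
      _ ≤ d + 1 := Nat.add_le_add_right (hd a) 1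

variable {V W : Type*} [Fintype V]

open Classical in
/-- The degree of a vertex; the virtual root `none` is considered to be joined to all vertices. -/
noncomputable def attachSize (G : SimpleGraph V) : Option V → ℕ
  | none => Fintype.card V
  | some v => G.degree v

open Classical in
/-- In the subgraph `G'` of `G` the vertices outside `low` are separated, and any copy of `H` in
`G'` in which some vertex is attached to a vertex outside `low` (or to the virtual root) has a
positive proportion `γ` of the conceivable alternatives there. The vertices in `low` have degree at
most `K` in `G`. -/
structure Clean [Fintype W] (H : SimpleGraph W) (G G' : SimpleGraph V) (r : V → V → Prop)
    (low : Set V) (K : ℕ) (γ : ℝ) : Prop extends Separated G' r low (Fintype.card W) where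
  le : G' ≤ G
  tree : IsTreeOrder r
  degree_le : ∀ v ∈ low, G.degree v ≤ K
  alt : ∀ a q, ∀ φ ∈ placements H G' (below r a) (attached G' low a) q,
    (∀ v, a = some v → v ∉ low) →
      γ * attachSize G a ≤ (alternatives H G' (below r a) (attached G' low a) q φ).ncard

variable [Fintype W]

open Classical in
theorem clean_univ (H : SimpleGraph W) {G G' : SimpleGraph V} (hle : G' ≤ G) {r : V → V → Prop}
    (hr : IsTreeOrder r) {K : ℕ} (hK : Fintype.card V ≤ K) {γ : ℝ} (hγ : γ * Fintype.card V ≤ 1) :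
    Clean H G G' r Set.univ K γ where
  low_or u v _ := Or.inl trivial
  up a x ha := absurd trivial ha
  chain x y _ _ _ a _ ha := absurd trivial ha
  le := hle
  tree := hr
  degree_le v _ := (SimpleGraph.degree_lt_card_verts _).le.trans hK
  alt a q φ hφ ha := by
    cases a with
    | some v => exact absurd trivial (ha v rfl)
    | none =>
      have hself : φ q ∈ alternatives H G' (below r none) (attached G' Set.univ none) q φ :=
        ⟨φ, hφ, rfl, fun _ _ => rfl⟩
      exact hγ.trans (Nat.one_le_cast.2 ((Set.ncard_pos (Set.toFinite _)).2 ⟨_, hself⟩))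

/-- A bound for the sum of the attachment numbers at a vertex of level at most `d`, for `H` with `h`
vertices. -/
def attachmentBound (d h : ℕ) : ℕ :=
  h * ((d + 1 + 1) ^ h * (h ^ 2 + 1) ^ h)

omit [Fintype V] in
theorem sum_attachmentNumber_le [Finite V] (H : SimpleGraph W) (G : SimpleGraph V)
    {r : V → V → Prop} {d : ℕ} (hd : ∀ v, treeLevel r v ≤ d) (low : Set V)
    (a : Option V) : ∑ q, attachmentNumber H G r low a q ≤ attachmentBound d (Fintype.card W) := by
  refine Finset.sum_le_card_nsmul _ _ _ fun q _ => (coverNumber_le _ fun _ hφ => hφ.2.2).trans ?_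
  gcongr
  exact ncard_below_le hd a

open Classical in
theorem sum_alternatives_cost_le (H : SimpleGraph W) (G G₁ : SimpleGraph V) {r : V → V → Prop}
    {d : ℕ} (hd : ∀ v, treeLevel r v ≤ d) (low : Set V) (K K' : ℕ) {γ : ℝ} (hγ : 0 ≤ γ) :
    ∑ a ∈ Finset.insertNone {u | K' < G.degree u}, ∑ q,
        (γ * attachSize G a + Fintype.card W) * attachCost K a * attachmentNumber H G₁ r low a q ≤
      attachmentBound d (Fintype.card W) * ((γ * Fintype.card V + Fintype.card W) * K +
        (γ * ∑ u, (G.degree u : ℝ) +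
          ({u | K' < G.degree u} : Finset V).card * Fintype.card W)) := by
  calc _ ≤ ∑ a ∈ Finset.insertNone {u | K' < G.degree u}, attachmentBound d (Fintype.card W) *
          ((γ * attachSize G a + Fintype.card W) * attachCost K a) := by
        refine Finset.sum_le_sum fun a _ => ?_
        rw [← Finset.mul_sum, mul_comm]
        gcongr
        exact_mod_cast sum_attachmentNumber_le H G₁ hd low a
    _ = attachmentBound d (Fintype.card W) * ((γ * Fintype.card V + Fintype.card W) * K +
          (γ * ∑ u with K' < G.degree u, (G.degree u : ℝ) +
            ({u | K' < G.degree u} : Finset V).card * Fintype.card W)) := by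
        rw [← Finset.mul_sum, Finset.sum_insertNone]
        simp only [attachSize, attachCost, Nat.cast_one, mul_one, Finset.sum_add_distrib,
          Finset.mul_sum, Finset.sum_const, nsmul_eq_mul]
    _ ≤ _ := by
        gcongr
        exact Finset.subset_univ _

open Classical in
theorem exists_clean_of_thresholds (H : SimpleGraph W) {G G₀ : SimpleGraph V} (hle : G₀ ≤ G)
    {r : V → V → Prop} (hr : IsTreeEmbedding G₀ r) {d : ℕ} (hd : ∀ v, treeLevel r v ≤ d)
    (K K' : ℕ) {γ : ℝ} (hγ : 0 ≤ γ) :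
    ∃ G' ≤ G₀, (edgeLoss G₀ G' : ℝ) ≤
        ∑ u with K < G.degree u ∧ G.degree u ≤ K', (G.degree u : ℝ) +
        ({u | K' < G.degree u} : Finset V).card * (d + d * (K + 1) ^ Fintype.card W +
          attachmentBound d (Fintype.card W) * Fintype.card W : ℕ) +
        attachmentBound d (Fintype.card W) *
          (γ * (Fintype.card V * K + ∑ u, (G.degree u : ℝ)) + Fintype.card W * K) ∧
      Clean H G G' r {v | G.degree v ≤ K} K γ := by
  obtain ⟨G₁, hle₁, hloss₁, hsep, hgap⟩ := exists_separated hle hr hd K K' (Fintype.card W)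
  obtain ⟨G₂, hle₂, hloss₂, halt⟩ := exists_many_alternatives H (G := G₁) r
    (low := {v | G.degree v ≤ K})
    (fun v hv => (SimpleGraph.degree_le_of_le (hle₁.trans hle)).trans hv)
    (Finset.insertNone {u | K' < G.degree u}) (τ := fun a => γ * attachSize G a)
    (fun a => mul_nonneg hγ (Nat.cast_nonneg _))
  refine ⟨G₂, hle₂.trans hle₁, ?_, ⟨hsep.anti hle₂, (hle₂.trans hle₁).trans hle, hr.1,
    fun v hv => hv, fun a q φ hφ ha => halt a ?_ q φ hφ⟩⟩
  · have htriangle : (edgeLoss G₀ G₂ : ℝ) ≤ edgeLoss G₀ G₁ + edgeLoss G₁ G₂ :=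
      mod_cast edgeLoss_triangle G₀ G₁ G₂
    have hseparate : (edgeLoss G₀ G₁ : ℝ) ≤
        ∑ u with K < G.degree u ∧ G.degree u ≤ K', (G.degree u : ℝ) +
        ({u | K' < G.degree u} : Finset V).card * (d + d * (K + 1) ^ Fintype.card W : ℕ) :=
      mod_cast hloss₁
    have hreroute := hloss₂.trans (sum_alternatives_cost_le H G G₁ hd _ K K' hγ)
    push_cast at hseparate ⊢
    linarith
  · cases a with
    | none => exact Finset.none_mem_insertNone
    | some v =>
      have hadj : G₁.Adj v (φ q) := hle₂ hφ.2.1.2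
      have hv : K' < G.degree v := (hgap v _ hadj).resolve_left (ha v rfl)
      exact Finset.some_mem_insertNone.2 (Finset.mem_filter.2 ⟨Finset.mem_univ v, hv⟩)

end Cleaning

open Classical in
theorem exists_clean {W : Type*} [Fintype W] (H : SimpleGraph W) (c d : ℕ) {ε : ℝ} (hε : 0 < ε) :
    ∃ (K : ℕ) (γ : ℝ), 0 < γ ∧ ∀ (V : Type*) [Fintype V] (G G₀ : SimpleGraph V)
      (r : V → V → Prop), G₀ ≤ G → IsTreeEmbedding G₀ r → (∀ v, treeLevel r v ≤ d) →
      ∑ v, G.degree v ≤ c * Fintype.card V →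
      ∃ G' ≤ G₀, (edgeLoss G₀ G' : ℝ) ≤ ε * Fintype.card V ∧ ∃ low, Clean H G G' r low K γ := by
  set h := Fintype.card W
  set M := attachmentBound d h
  have hε' : 0 < ε / 4 := by positivity
  obtain ⟨κ, hκ⟩ := exists_thresholds (fun K => d + d * (K + 1) ^ h + M * h) c hε'
  obtain ⟨n₀, hn₀⟩ := exists_nat_ge ((M * (h * κ) : ℝ) / (ε / 4))
  rw [div_le_iff₀' hε'] at hn₀
  obtain ⟨γ, hγ, hsmall⟩ := exists_pos_mul_lt (lt_min hε' one_pos) (M * (κ + c) + n₀ : ℝ)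
  obtain ⟨hγε, hγ1⟩ := lt_min_iff.1 hsmall
  have hMγ : M * (γ * (κ + c)) ≤ ε / 4 := by nlinarith [mul_nonneg n₀.cast_nonneg hγ.le]
  refine ⟨max κ n₀, γ, hγ, fun V _ G G₀ r hle hr hd hdeg => ?_⟩
  rcases le_or_gt (Fintype.card V) n₀ with hn | hn
  · have hγn : γ * Fintype.card V ≤ 1 :=
      calc γ * Fintype.card V ≤ n₀ * γ := by rw [mul_comm]; gcongr
        _ ≤ (M * (κ + c) + n₀) * γ := by gcongr; exact le_add_of_nonneg_left (by positivity)
        _ ≤ 1 := hγ1.le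
    refine ⟨G₀, le_rfl, ?_, Set.univ, clean_univ H hle hr.1 (hn.trans (le_max_right _ _)) hγn⟩
    rw [edgeLoss_self, Nat.cast_zero]
    positivity
  · obtain ⟨K, hK, K', hgap, hhigh⟩ := hκ V (fun v => G.degree v) hdeg
    obtain ⟨G', hle', hloss, hclean⟩ := exists_clean_of_thresholds H hle hr hd K K' hγ.le
    refine ⟨G', hle', hloss.trans ?_, _, { hclean with
      degree_le := fun v hv => (hclean.degree_le v hv).trans (hK.trans (le_max_left _ _)) }⟩
    have hdeg' : ∑ v, (G.degree v : ℝ) ≤ c * Fintype.card V := mod_cast hdeg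
    have hγ_term : M * (γ * (Fintype.card V * K + ∑ u, (G.degree u : ℝ))) ≤
        ε / 4 * Fintype.card V :=
      calc _ ≤ M * (γ * (Fintype.card V * κ + c * Fintype.card V)) := by gcongr
        _ = M * (γ * (κ + c)) * Fintype.card V := by ring
        _ ≤ ε / 4 * Fintype.card V := by gcongr
    have hroot_term : (M * (h * K) : ℝ) ≤ ε / 4 * Fintype.card V :=
      calc (M * (h * K) : ℝ) ≤ M * (h * κ) := by gcongr
        _ ≤ ε / 4 * n₀ := hn₀
        _ ≤ ε / 4 * Fintype.card V := by gcongr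
    linarith

/-! ### Exploring a copy -/

section Exploration

variable {V W : Type*}

/-- The vertices of `D` to which the component of `x` in the rest of `H` is attached. -/
def boundary (H : SimpleGraph W) (D : Set W) (x : W) : Set W :=
  {p | p ∈ D ∧ ∃ z, (within H Dᶜ).Reachable x z ∧ H.Adj p z}

/-- The set `D` of vertices of `H` has been explored by following edges from vertices that the copy
`φ` maps into `low`; components of the rest of `H` are attached to chains of the tree order. -/
structure IsExplored (H : SimpleGraph W) (r : V → V → Prop) (low : Set V) (φ : W → V)
    (D : Set W) : Prop where
  closed : ∀ p ∈ D, φ p ∈ low → ∀ q, H.Adj p q → q ∈ D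
  high : ∀ p ∈ D, φ p ∉ low → ∃ t ∈ D, φ t ∈ low ∧ H.Adj p t
  chain : ∀ x ∉ D, ∀ p ∈ boundary H D x, ∀ p' ∈ boundary H D x,
    r (φ p) (φ p') ∨ r (φ p') (φ p)

/-- The images of the edges in `E` under `φ` have been found, as edges of `F`; each component of the
part of `D` mapped into `low` meets one of them. -/
structure IsFound (H : SimpleGraph W) (F : SimpleGraph V) (low : Set V) (φ : W → V) (D : Set W)
    (E : Set (Sym2 W)) : Prop where
  sub : E ⊆ H.edgeSet
  found : ∀ p q, s(p, q) ∈ E → F.Adj (φ p) (φ q)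
  ends : ∀ p q, s(p, q) ∈ E → p ∈ D
  conn : ∀ p ∈ D, φ p ∈ low → ∃ t u, φ t ∈ low ∧ s(t, u) ∈ E ∧
    (within H {x | x ∈ D ∧ φ x ∈ low}).Reachable t p

/-- The map `φ'` arises from `φ` by an alternative choice at the vertex `q`, not yet in `D`, when
`a` is the greatest vertex to which the unexplored component of `q` is attached (the virtual root
`none` if there is no such vertex). -/
structure IsRerouting (H : SimpleGraph W) (G : SimpleGraph V) (r : V → V → Prop) (low : Set V)
    (φ φ' : W → V) (D : Set W) (q : W) (a : Option V) : Prop where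
  notMem : q ∉ D
  boundary_below : ∀ p ∈ boundary H D q, φ p ∈ below r a
  attached : ∀ c, a = some c → ∃ p ∈ D, φ p = c ∧ φ p ∉ low ∧ H.Adj p q
  copy : IsCopy H G φ'
  low : φ' q ∈ low
  off : ∀ x, ¬ (within H (φ ⁻¹' below r a)ᶜ).Reachable q x → φ' x = φ x

/-- The component of `q` in the part of `H` that `φ` maps into `low`. -/
def lowComponent (H : SimpleGraph W) (low : Set V) (φ : W → V) (q : W) : Set W :=
  {x | (within H (φ ⁻¹' low)).Reachable q x}

/-- The extension of `D` by the component of `q` among the vertices mapped into `low`, together with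
the neighbors of this component. -/
def exploreFrom (H : SimpleGraph W) (low : Set V) (φ : W → V) (D : Set W) (q : W) : Set W :=
  {x | x ∈ D ∨ x ∈ lowComponent H low φ q ∨ ∃ y ∈ lowComponent H low φ q, H.Adj y x}

variable {H : SimpleGraph W} {G : SimpleGraph V} {r : V → V → Prop} {low : Set V}
  {F F' : SimpleGraph V} {φ φ' : W → V} {D : Set W} {E : Set (Sym2 W)} {q : W} {a : Option V}

theorem reachable_within_of_forall_adj {S T : Set W} (hq : q ∈ T)
    (hST : ∀ x y, (within H T).Reachable q x → H.Adj x y → y ∈ S → y ∈ T) {x : W}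
    (hx : (within H S).Reachable q x) : (within H T).Reachable q x := by
  induction (SimpleGraph.reachable_iff_reflTransGen _ _).1 hx with
  | refl => exact SimpleGraph.Reachable.refl q
  | tail hqx hxy ih =>
    have hreach := ih ((SimpleGraph.reachable_iff_reflTransGen _ _).2 hqx)
    exact reachable_within_of_adj hq hreach hxy.1 (hST _ _ hreach hxy.1 hxy.2.2)

theorem mem_low_of_mem_lowComponent (hq : φ q ∈ low) {x : W} (hx : x ∈ lowComponent H low φ q) :
    φ x ∈ low :=
  mem_of_reachable_within (S := φ ⁻¹' low) hx hq

theorem mem_lowComponent_of_adj (hq : φ q ∈ low) {x y : W} (hx : x ∈ lowComponent H low φ q)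
    (hxy : H.Adj x y) (hy : φ y ∈ low) : y ∈ lowComponent H low φ q :=
  reachable_within_of_adj (S := φ ⁻¹' low) hq hx hxy hy

theorem Separated.chain_of_reachable [Fintype W] (hsep : Separated G r low (Fintype.card W))
    (hφ : IsCopy H G φ) {x y p p' : W} (hx : φ x ∈ low)
    (hxy : (within H (φ ⁻¹' low)).Reachable x y) (hp : φ p ∉ low) (hp' : φ p' ∉ low)
    (hpx : H.Adj p x) (hpy : H.Adj p' y) : r (φ p) (φ p') ∨ r (φ p') (φ p) := by
  classical
  obtain ⟨w, hw⟩ := hxy.exists_isPath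
  let f : within H (φ ⁻¹' low) →g within G low :=
    ⟨φ, fun {u v} h => ⟨hφ.adj u v h.1, h.2.1, h.2.2⟩⟩
  refine hsep.chain (φ x) (φ y) hx (w.map f) ?_ _ _ hp hp' (hφ.adj _ _ hpx) (hφ.adj _ _ hpy)
  rw [SimpleGraph.Walk.length_map]
  exact hw.length_lt.le

namespace IsRerouting

variable (h : IsRerouting H G r low φ φ' D q a)

include h

theorem eq_of_not_reachable {x : W} (hx : ¬ (within H Dᶜ).Reachable q x) : φ' x = φ x :=
  h.off x fun hreach => hx <| reachable_within_of_forall_adj (S := (φ ⁻¹' below r a)ᶜ) h.notMem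
    (fun y z hy hyz hz hzD => hz (h.boundary_below z ⟨hzD, y, hy, hyz.symm⟩)) hreach

theorem eq_of_mem {x : W} (hx : x ∈ D) : φ' x = φ x :=
  h.eq_of_not_reachable fun hreach => mem_of_reachable_within (S := Dᶜ) hreach h.notMem hx

theorem reachable_of_mem_lowComponent (hex : IsExplored H r low φ D) {x : W}
    (hx : x ∈ lowComponent H low φ' q) : (within H Dᶜ).Reachable q x :=
  reachable_within_of_forall_adj h.notMem (fun y z hy hyz hz hzD =>
    mem_of_reachable_within (S := Dᶜ) hy h.notMem
      (hex.closed z hzD (h.eq_of_mem hzD ▸ hz) y hyz.symm)) hx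

theorem closed_exploreFrom (hex : IsExplored H r low φ D) :
    ∀ p ∈ exploreFrom H low φ' D q, φ' p ∈ low → ∀ u, H.Adj p u →
      u ∈ exploreFrom H low φ' D q := by
  rintro p (hp | hp | ⟨y, hy, hyp⟩) hlow u hpu
  · exact Or.inl (hex.closed p hp (h.eq_of_mem hp ▸ hlow) u hpu)
  · exact Or.inr (Or.inr ⟨p, hp, hpu⟩)
  · exact Or.inr (Or.inr ⟨p, mem_lowComponent_of_adj h.low hy hyp hlow, hpu⟩)

theorem high_exploreFrom (hex : IsExplored H r low φ D) :
    ∀ p ∈ exploreFrom H low φ' D q, φ' p ∉ low →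
      ∃ t ∈ exploreFrom H low φ' D q, φ' t ∈ low ∧ H.Adj p t := by
  rintro p (hp | hp | ⟨u, hu, hup⟩) hhigh
  · obtain ⟨t, ht, hlow, hpt⟩ := hex.high p hp (h.eq_of_mem hp ▸ hhigh)
    exact ⟨t, Or.inl ht, (h.eq_of_mem ht).symm ▸ hlow, hpt⟩
  · exact absurd (mem_low_of_mem_lowComponent h.low hp) hhigh
  · exact ⟨u, Or.inr (Or.inl hu), mem_low_of_mem_lowComponent h.low hu, hup.symm⟩

theorem notMem_low_of_mem_boundary (hex : IsExplored H r low φ D) {x p : W}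
    (hx : x ∉ exploreFrom H low φ' D q) (hp : p ∈ boundary H (exploreFrom H low φ' D q) x) :
    φ' p ∉ low := by
  obtain ⟨hpD, z, hxz, hpz⟩ := hp
  exact fun hlow => mem_of_reachable_within (S := (exploreFrom H low φ' D q)ᶜ) hxz hx
    (h.closed_exploreFrom hex p hpD hlow z hpz)

omit h in
theorem reachable_of_reachable_exploreFrom {x y : W}
    (hxy : (within H (exploreFrom H low φ' D q)ᶜ).Reachable x y) :
    (within H Dᶜ).Reachable x y :=
  hxy.mono (within_mono le_rfl (Set.compl_subset_compl.2 fun _ => Or.inl))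

theorem mem_boundary_or_adj (hex : IsExplored H r low φ D) {x p : W}
    (hx : x ∉ exploreFrom H low φ' D q) (hqx : (within H Dᶜ).Reachable q x)
    (hp : p ∈ boundary H (exploreFrom H low φ' D q) x) :
    p ∈ boundary H D q ∨ ∃ u ∈ lowComponent H low φ' q, H.Adj p u := by
  have hhigh := h.notMem_low_of_mem_boundary hex hx hp
  obtain ⟨hpD | hpL | ⟨u, hu, hup⟩, z, hxz, hpz⟩ := hp
  · exact Or.inl ⟨hpD, z, hqx.trans (reachable_of_reachable_exploreFrom hxz), hpz⟩
  · exact absurd (mem_low_of_mem_lowComponent h.low hpL) hhigh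
  · exact Or.inr ⟨u, hu, hup.symm⟩

theorem mem_boundary_of_not_reachable (hex : IsExplored H r low φ D) {x p : W}
    (hx : x ∉ exploreFrom H low φ' D q) (hqx : ¬ (within H Dᶜ).Reachable q x)
    (hp : p ∈ boundary H (exploreFrom H low φ' D q) x) : p ∈ boundary H D x := by
  obtain ⟨hpD', z, hxz, hpz⟩ := hp
  have hxz' : (within H Dᶜ).Reachable x z := reachable_of_reachable_exploreFrom hxz
  have hzD : z ∉ D := mem_of_reachable_within (S := Dᶜ) hxz' fun hxD => hx (Or.inl hxD)
  suffices hpD : p ∈ D from ⟨hpD, z, hxz', hpz⟩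
  by_contra hpD
  have hqp : (within H Dᶜ).Reachable q p := by
    rcases hpD' with hpD' | hpL | ⟨u, hu, hup⟩
    · exact absurd hpD' hpD
    · exact h.reachable_of_mem_lowComponent hex hpL
    · exact reachable_within_of_adj h.notMem (h.reachable_of_mem_lowComponent hex hu) hup hpD
  exact hqx ((reachable_within_of_adj h.notMem hqp hpz hzD).trans hxz'.symm)

/-- Below `a`, everything is a chain; a vertex next to the new component is comparable to `a`
because the graph is separated, hence to everything below `a`. -/
theorem comparable_of_mem_boundary [Fintype W] (hr : IsTreeOrder r)
    (hsep : Separated G r low (Fintype.card W)) {p p' u : W} (hp : p ∈ boundary H D q)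
    (hp' : φ' p' ∉ low) (hu : u ∈ lowComponent H low φ' q) (hpu : H.Adj p' u) :
    r (φ' p) (φ' p') ∨ r (φ' p') (φ' p) := by
  have hbelow := h.boundary_below p hp
  rw [← h.eq_of_mem hp.1] at hbelow
  cases a with
  | none => exact absurd hbelow (Set.notMem_empty _)
  | some c =>
    obtain ⟨b, hb, rfl, hhigh, hbq⟩ := h.attached c rfl
    rw [← h.eq_of_mem hb] at hbelow hhigh
    rcases hsep.chain_of_reachable h.copy h.low hu hhigh hp' hbq hpu with hle | hle
    · exact Or.inl (hr.trans _ _ _ hbelow hle)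
    · exact hr.total_below _ _ _ hbelow hle

theorem isExplored [Fintype W] (hr : IsTreeOrder r) (hsep : Separated G r low (Fintype.card W))
    (hex : IsExplored H r low φ D) : IsExplored H r low φ' (exploreFrom H low φ' D q) where
  closed := h.closed_exploreFrom hex
  high := h.high_exploreFrom hex
  chain x hx p hp p' hp' := by
    have hhigh := h.notMem_low_of_mem_boundary hex hx hp
    have hhigh' := h.notMem_low_of_mem_boundary hex hx hp'
    have hxD : x ∉ D := fun hxD => hx (Or.inl hxD)
    by_cases hqx : (within H Dᶜ).Reachable q x
    · rcases h.mem_boundary_or_adj hex hx hqx hp with hpq | ⟨u, hu, hpu⟩ <;>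
        rcases h.mem_boundary_or_adj hex hx hqx hp' with hpq' | ⟨u', hu', hpu'⟩
      · rw [h.eq_of_mem hpq.1, h.eq_of_mem hpq'.1]
        exact hex.chain q h.notMem p hpq p' hpq'
      · exact h.comparable_of_mem_boundary hr hsep hpq hhigh' hu' hpu'
      · exact (h.comparable_of_mem_boundary hr hsep hpq' hhigh hu hpu).symm
      · exact hsep.chain_of_reachable h.copy (mem_low_of_mem_lowComponent h.low hu)
          (SimpleGraph.Reachable.trans (SimpleGraph.Reachable.symm hu) hu') hhigh hhigh' hpu hpu'
    · have hpx := h.mem_boundary_of_not_reachable hex hx hqx hp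
      have hpx' := h.mem_boundary_of_not_reachable hex hx hqx hp'
      rw [h.eq_of_mem hpx.1, h.eq_of_mem hpx'.1]
      exact hex.chain x hxD p hpx p' hpx'

theorem conn_exploreFrom (hf : IsFound H F low φ D E) (s : W) :
    ∀ p ∈ exploreFrom H low φ' D q, φ' p ∈ low → ∃ t u, φ' t ∈ low ∧ s(t, u) ∈ insert s(q, s) E ∧
      (within H {x | x ∈ exploreFrom H low φ' D q ∧ φ' x ∈ low}).Reachable t p := by
  intro p hp hlow
  by_cases hpD : p ∈ D
  · obtain ⟨t, u, ht, htu, htp⟩ := hf.conn p hpD (h.eq_of_mem hpD ▸ hlow)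
    refine ⟨t, u, (h.eq_of_mem (hf.ends t u htu)).symm ▸ ht, Or.inr htu,
      htp.mono (within_mono le_rfl fun x hx => ⟨Or.inl hx.1, ?_⟩)⟩
    exact (h.eq_of_mem hx.1).symm ▸ hx.2
  · have hpL : p ∈ lowComponent H low φ' q := by
      rcases hp with hp | hp | ⟨u, hu, hup⟩
      · exact absurd hp hpD
      · exact hp
      · exact mem_lowComponent_of_adj h.low hu hup hlow
    have hq : q ∈ exploreFrom H low φ' D q := Or.inr (Or.inl (SimpleGraph.Reachable.refl q))
    refine ⟨q, s, h.low, Or.inl rfl, reachable_within_of_forall_adj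
      (T := {x | x ∈ exploreFrom H low φ' D q ∧ φ' x ∈ low}) ⟨hq, h.low⟩
      (fun x y hx hxy hy => ?_) hpL⟩
    have hxL : x ∈ lowComponent H low φ' q := hx.mono (within_mono le_rfl fun _ => And.right)
    exact ⟨Or.inr (Or.inr ⟨x, hxL, hxy⟩), hy⟩

theorem isFound (hf : IsFound H F low φ D E) (hF : F ≤ F') {s : W} (hqs : H.Adj q s)
    (hfound : F'.Adj (φ' q) (φ' s)) :
    IsFound H F' low φ' (exploreFrom H low φ' D q) (insert s(q, s) E) where
  sub := Set.insert_subset hqs hf.sub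
  found p u hpu := by
    rcases hpu with hpu | hpu
    · rcases Sym2.eq_iff.1 hpu with ⟨rfl, rfl⟩ | ⟨rfl, rfl⟩
      · exact hfound
      · exact hfound.symm
    · rw [h.eq_of_mem (hf.ends p u hpu), h.eq_of_mem (hf.ends u p (Sym2.eq_swap ▸ hpu))]
      exact hF (hf.found p u hpu)
  ends p u hpu := by
    have hqL : q ∈ lowComponent H low φ' q := SimpleGraph.Reachable.refl q
    rcases hpu with hpu | hpu
    · rcases Sym2.eq_iff.1 hpu with ⟨rfl, rfl⟩ | ⟨rfl, rfl⟩
      · exact Or.inr (Or.inl hqL)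
      · exact Or.inr (Or.inr ⟨_, hqL, hqs⟩)
    · exact Or.inl (hf.ends p u hpu)
  conn := h.conn_exploreFrom hf s

end IsRerouting

theorem IsFound.insert (hf : IsFound H F low φ D E) (hF : F ≤ F') {t u : W} (ht : t ∈ D)
    (hu : u ∈ D) (htu : H.Adj t u) (hfound : F'.Adj (φ t) (φ u)) :
    IsFound H F' low φ D (insert s(t, u) E) where
  sub := Set.insert_subset htu hf.sub
  found p q hpq := by
    rcases hpq with hpq | hpq
    · rcases Sym2.eq_iff.1 hpq with ⟨rfl, rfl⟩ | ⟨rfl, rfl⟩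
      · exact hfound
      · exact hfound.symm
    · exact hF (hf.found p q hpq)
  ends p q hpq := by
    rcases hpq with hpq | hpq
    · rcases Sym2.eq_iff.1 hpq with ⟨rfl, -⟩ | ⟨rfl, -⟩
      · exact ht
      · exact hu
    · exact hf.ends p q hpq
  conn p hp hlow :=
    let ⟨t, u, ht, htu, htp⟩ := hf.conn p hp hlow
    ⟨t, u, ht, Or.inr htu, htp⟩

theorem IsFound.saturated (hf : IsFound H F low φ D E)
    (hsat : ∀ t u v, s(t, u) ∈ E → φ t ∈ low → H.Adj t v → s(t, v) ∈ E) :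
    ∀ p ∈ D, φ p ∈ low → ∀ u, H.Adj p u → s(p, u) ∈ E := by
  intro p hp hlow
  obtain ⟨t, u, ht, htu, htp⟩ := hf.conn p hp hlow
  induction (SimpleGraph.reachable_iff_reflTransGen _ _).1 htp with
  | refl => exact fun v hv => hsat t u v htu ht hv
  | @tail x y htx hxy ih =>
    have hx := ih hxy.2.1.1 hxy.2.1.2 ((SimpleGraph.reachable_iff_reflTransGen _ _).2 htx)
    exact fun v hv => hsat y x v (Sym2.eq_swap ▸ hx y hxy.1) hxy.2.2.2 hv

/-- There is a partially explored copy of `H` in `G` of which at most `m` edges are missing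
from `F`. -/
def Explorable (H : SimpleGraph W) (G : SimpleGraph V) (r : V → V → Prop) (low : Set V) (m : ℕ)
    (F : SimpleGraph V) : Prop :=
  ∃ φ D E, IsCopy H G φ ∧ IsExplored H r low φ D ∧ IsFound H F low φ D E ∧
    H.edgeSet.ncard ≤ E.ncard + m

theorem Explorable.mono {m m' : ℕ} (h : Explorable H G r low m F) (hm : m ≤ m') (hF : F ≤ F') :
    Explorable H G r low m' F' := by
  obtain ⟨φ, D, E, hφ, hex, hf, hE⟩ := h
  exact ⟨φ, D, E, hφ, hex, { hf with found := fun p q h => hF (hf.found p q h) }, by omega⟩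

theorem IsCopy.explorable (hφ : IsCopy H G φ) : Explorable H G r low H.edgeSet.ncard F :=
  ⟨φ, ∅, ∅, hφ, ⟨nofun, nofun, fun _ _ _ hp => hp.1.elim⟩,
    ⟨Set.empty_subset _, nofun, nofun, nofun⟩, Nat.le_add_left _ _⟩

theorem Explorable.exists_isCopy [Finite W] (h : Explorable H G r low 0 F) :
    ∃ φ, IsCopy H F φ := by
  obtain ⟨φ, D, E, hφ, -, hf, hE⟩ := h
  have hall : E = H.edgeSet := Set.eq_of_subset_of_ncard_le hf.sub hE (Set.toFinite _)
  exact ⟨φ, hφ.inj, fun p q hpq => hf.found p q (hall ▸ hpq)⟩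

theorem Explorable.of_insert [Finite W] {m : ℕ} {e : Sym2 W} (hφ : IsCopy H G φ)
    (hex : IsExplored H r low φ D) (hf : IsFound H F low φ D (insert e E)) (he : e ∉ E)
    (hE : H.edgeSet.ncard ≤ E.ncard + (m + 1)) : Explorable H G r low m F := by
  refine ⟨φ, D, _, hφ, hex, hf, ?_⟩
  rw [Set.ncard_insert_of_notMem he (Set.toFinite E)]
  omega

theorem IsRerouting.explorable [Fintype W] {m : ℕ} (h : IsRerouting H G r low φ φ' D q a)
    (hr : IsTreeOrder r) (hsep : Separated G r low (Fintype.card W))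
    (hex : IsExplored H r low φ D) (hf : IsFound H F low φ D E)
    (hE : H.edgeSet.ncard ≤ E.ncard + (m + 1)) (hF : F ≤ F') {s : W}
    (hqs : H.Adj q s) (hfound : F'.Adj (φ' q) (φ' s)) : Explorable H G r low m F' :=
  .of_insert h.copy (h.isExplored hr hsep hex) (h.isFound hf hF hqs hfound)
    (fun hE => h.notMem (hf.ends q s hE)) hE

theorem IsExplored.exists_adj_low_notMem [Fintype W]
    (hsep : Separated G r low (Fintype.card W))
    (hφ : IsCopy H G φ) (hall : ∀ p ∈ D, φ p ∈ low → ∀ u, H.Adj p u → s(p, u) ∈ E)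
    (hlt : E.ncard < H.edgeSet.ncard) : ∃ q s, H.Adj q s ∧ φ q ∈ low ∧ q ∉ D := by
  obtain ⟨e, he, heE⟩ := Set.exists_mem_notMem_of_ncard_lt_ncard hlt (Set.toFinite E)
  induction e with
  | _ q s =>
    rcases hsep.low_or _ _ (hφ.adj q s he) with hlow | hlow
    · exact ⟨q, s, he, hlow, fun hq => heE (hall q hq hlow s he)⟩
    · exact ⟨s, q, he.symm, hlow, fun hs => heE (Sym2.eq_swap ▸ hall s hs hlow q he.symm)⟩

open Classical in
/-- A random neighbor in `G` of some endpoint of an edge of `F` is, with probability at least `δ`,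
one whose addition to `F` brings about `P`. -/
def EdgeProgress [Fintype V] (δ : ℝ) (G F : SimpleGraph V) (P : SimpleGraph V → Prop) : Prop :=
  ∃ v u, F.Adj v u ∧ ∃ Y ⊆ G.neighborFinset v, Y.Nonempty ∧ δ * G.degree v ≤ Y.card ∧
    ∀ y ∈ Y, ∀ F', F ≤ F' → F'.Adj v y → P F'

open Classical in
/-- A random vertex has, with probability at least `δ`, degree at most `K` in `G` and an incident
edge whose addition to `F` brings about `P`. -/
def VertexProgress [Fintype V] (δ : ℝ) (K : ℕ) (G F : SimpleGraph V)
    (P : SimpleGraph V → Prop) : Prop :=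
  ∃ Y : Finset V, Y.Nonempty ∧ δ * Fintype.card V ≤ Y.card ∧
    ∀ y ∈ Y, G.degree y ≤ K ∧ ∃ z, G.Adj y z ∧ ∀ F', F ≤ F' → F'.Adj y z → P F'

theorem exists_greatest {s : Finset W} (hs : s.Nonempty) (hr : IsTreeOrder r)
    (hchain : ∀ p ∈ s, ∀ p' ∈ s, r (φ p) (φ p') ∨ r (φ p') (φ p)) :
    ∃ p ∈ s, ∀ p' ∈ s, r (φ p') (φ p) := by
  let R : s → s → Prop := fun p p' => r (φ p) (φ p')
  have : IsTrans s R := ⟨fun _ _ _ => hr.trans _ _ _⟩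
  have hdir : Directed R id := fun p p' => (hchain p p.2 p' p'.2).elim
    (fun h => ⟨p', h, hr.refl _⟩) (fun h => ⟨p, hr.refl _, h⟩)
  have : Nonempty s := hs.to_subtype
  obtain ⟨p, hp⟩ := hdir.finset_le Finset.univ
  exact ⟨p, p.2, fun p' hp' => hp ⟨p', hp'⟩ (Finset.mem_univ _)⟩

section Progress

variable [Fintype V] [Fintype W] {G₀ : SimpleGraph V} {K m : ℕ} {γ δ : ℝ}

theorem IsFound.edgeProgress (hc : Clean H G₀ G r low K γ) (hδK : δ * K ≤ 1) (hδ : 0 ≤ δ)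
    (hφ : IsCopy H G φ) (hex : IsExplored H r low φ D) (hf : IsFound H F low φ D E)
    (hE : H.edgeSet.ncard ≤ E.ncard + (m + 1)) {t u v : W} (htu : s(t, u) ∈ E)
    (hlow : φ t ∈ low) (htv : H.Adj t v) (hnew : s(t, v) ∉ E) :
    EdgeProgress δ G₀ F (Explorable H G r low m) := by
  classical
  refine ⟨φ t, φ u, hf.found t u htu, {φ v}, ?_, Finset.singleton_nonempty _, ?_, ?_⟩
  · rw [Finset.singleton_subset_iff, SimpleGraph.mem_neighborFinset]
    exact hc.le (hφ.adj t v htv)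
  · rw [Finset.card_singleton, Nat.cast_one]
    exact (mul_le_mul_of_nonneg_left (Nat.cast_le.2 (hc.degree_le _ hlow)) hδ).trans hδK
  · intro y hy F' hF hF'
    rw [Finset.mem_singleton.1 hy] at hF'
    have ht := hf.ends t u htu
    exact .of_insert hφ hex (hf.insert hF ht (hex.closed t ht hlow v htv) htv hF') hnew hE

/-- The component of `q` in the unexplored part of `H` is attached to `φ p`, a vertex outside `low`
that is an end of a found edge; its neighbors in `alternatives` continue the exploration. -/
theorem IsExplored.edgeProgress_of_boundary (hc : Clean H G₀ G r low K γ) (hδγ : δ ≤ γ)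
    (hφ : IsCopy H G φ) (hex : IsExplored H r low φ D) (hf : IsFound H F low φ D E)
    (hE : H.edgeSet.ncard ≤ E.ncard + (m + 1))
    (hall : ∀ p ∈ D, φ p ∈ low → ∀ u, H.Adj p u → s(p, u) ∈ E) {p q : W} (hp : p ∈ D)
    (hq : q ∉ D) (hpq : H.Adj p q) (hmax : ∀ p' ∈ boundary H D q, r (φ p') (φ p)) :
    EdgeProgress δ G₀ F (Explorable H G r low m) := by
  classical
  have hhigh : φ p ∉ low := fun h => hq (hex.closed p hp h q hpq)
  have hlow : φ q ∈ low := (hc.low_or _ _ (hφ.adj p q hpq)).resolve_left hhigh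
  obtain ⟨t, ht, htlow, hpt⟩ := hex.high p hp hhigh
  have hmem : φ ∈ placements H G (below r (some (φ p))) (attached G low (some (φ p))) q :=
    ⟨hφ, ⟨hlow, hφ.adj p q hpq⟩, hc.up _ _ hhigh (hφ.adj p q hpq)⟩
  refine ⟨φ p, φ t, (hf.found t p (hall t ht htlow p hpt.symm)).symm, (alternatives H G
    (below r (some (φ p))) (attached G low (some (φ p))) q φ).toFinset, ?_, ?_, ?_, ?_⟩
  · intro y hy
    obtain ⟨φ', hφ', rfl, -⟩ := Set.mem_toFinset.1 hy
    exact (SimpleGraph.mem_neighborFinset _ _ _).2 (hc.le hφ'.2.1.2)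
  · exact ⟨φ q, Set.mem_toFinset.2 ⟨φ, hmem, rfl, fun _ _ => rfl⟩⟩
  · rw [← Set.ncard_eq_toFinset_card']
    exact (mul_le_mul_of_nonneg_right hδγ (Nat.cast_nonneg _)).trans <|
      hc.alt (some (φ p)) q φ hmem fun v hv => Option.some.inj hv ▸ hhigh
  · intro y hy F' hF hF'
    obtain ⟨φ', hφ', rfl, hoff⟩ := Set.mem_toFinset.1 hy
    have hrerouting : IsRerouting H G r low φ φ' D q (some (φ p)) :=
      ⟨hq, hmax, fun c hcp => ⟨p, hp, Option.some.inj hcp, hhigh, hpq⟩, hφ'.1, hφ'.2.1.1, hoff⟩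
    exact hrerouting.explorable hc.tree hc.toSeparated hex hf hE hF hpq.symm
      (hrerouting.eq_of_mem hp ▸ hF'.symm)

/-- The component of `q` in the unexplored part of `H` is not attached to anything, and the
exploration continues at a random vertex. -/
theorem IsExplored.vertexProgress (hc : Clean H G₀ G r low K γ) (hδγ : δ ≤ γ)
    (hφ : IsCopy H G φ) (hex : IsExplored H r low φ D) (hf : IsFound H F low φ D E)
    (hE : H.edgeSet.ncard ≤ E.ncard + (m + 1)) {q s : W} (hqs : H.Adj q s) (hlow : φ q ∈ low)
    (hq : q ∉ D) (hboundary : boundary H D q = ∅) :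
    VertexProgress δ K G₀ F (Explorable H G r low m) := by
  classical
  have hmem : φ ∈ placements H G (below r none) (attached G low none) q :=
    ⟨hφ, ⟨hlow, _, hφ.adj q s hqs⟩, Set.notMem_empty _⟩
  refine ⟨(alternatives H G (below r none) (attached G low none) q φ).toFinset, ?_, ?_, ?_⟩
  · exact ⟨φ q, Set.mem_toFinset.2 ⟨φ, hmem, rfl, fun _ _ => rfl⟩⟩
  · rw [← Set.ncard_eq_toFinset_card']
    exact (mul_le_mul_of_nonneg_right hδγ (Nat.cast_nonneg _)).trans (hc.alt none q φ hmem nofun)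
  · intro y hy
    obtain ⟨φ', hφ', rfl, hoff⟩ := Set.mem_toFinset.1 hy
    have hrerouting : IsRerouting H G r low φ φ' D q none :=
      ⟨hq, by simp only [hboundary, Set.mem_empty_iff_false, false_implies, implies_true],
        nofun, hφ'.1, hφ'.2.1.1, hoff⟩
    exact ⟨hc.degree_le _ hφ'.2.1.1, φ' s, hc.le (hφ'.1.adj q s hqs), fun F' hF hF' =>
      hrerouting.explorable hc.tree hc.toSeparated hex hf hE hF hqs hF'⟩

theorem Explorable.progress (hc : Clean H G₀ G r low K γ) (hδγ : δ ≤ γ) (hδK : δ * K ≤ 1)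
    (hδ : 0 ≤ δ) (h : Explorable H G r low (m + 1) F) :
    Explorable H G r low m F ∨ EdgeProgress δ G₀ F (Explorable H G r low m) ∨
      VertexProgress δ K G₀ F (Explorable H G r low m) := by
  classical
  obtain ⟨φ, D, E, hφ, hex, hf, hE⟩ := h
  rcases le_or_gt H.edgeSet.ncard (E.ncard + m) with hle | hlt
  · exact Or.inl ⟨φ, D, E, hφ, hex, hf, hle⟩
  by_cases! hsat : ∃ t u v, s(t, u) ∈ E ∧ φ t ∈ low ∧ H.Adj t v ∧ s(t, v) ∉ E
  · obtain ⟨t, u, v, htu, hlow, htv, hnew⟩ := hsat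
    exact Or.inr (Or.inl (hf.edgeProgress hc hδK hδ hφ hex hE htu hlow htv hnew))
  have hall := hf.saturated hsat
  obtain ⟨x, s, hxs, hlow, hx⟩ :=
    IsExplored.exists_adj_low_notMem hc.toSeparated hφ hall (by omega)
  rcases (boundary H D x).eq_empty_or_nonempty with hempty | hne
  · exact Or.inr (Or.inr (hex.vertexProgress hc hδγ hφ hf hE hxs hlow hx hempty))
  obtain ⟨p, hp, hmax⟩ := exists_greatest (φ := φ) (Set.toFinset_nonempty.2 hne) hc.tree
    fun p hp p' hp' => hex.chain x hx p (Set.mem_toFinset.1 hp) p' (Set.mem_toFinset.1 hp')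
  obtain ⟨hpD, q, hxq, hpq⟩ := Set.mem_toFinset.1 hp
  have hq : q ∉ D := mem_of_reachable_within (S := Dᶜ) hxq hx
  refine Or.inr (Or.inl (hex.edgeProgress_of_boundary hc hδγ hφ hf hE hall hpD hq hpq ?_))
  rintro p' ⟨hp', z, hqz, hpz⟩
  exact hmax p' (Set.mem_toFinset.2 ⟨hp', z, hxq.trans hqz, hpz⟩)

end Progress

end Exploration

/-! ### Clean subgraphs of graphs that are far from being `H`-free -/

section Far

variable {W : Type*} {H : SimpleGraph W} {ε : ℝ} {n : ℕ} {G : SimpleGraph (Fin n)}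

theorem IsFar.exists_isCopy (hfar : IsFar ε (FreeOf H) G) {G' : SimpleGraph (Fin n)} (hle : G' ≤ G)
    (hloss : (edgeLoss G G' : ℝ) ≤ ε * n) : ∃ φ, IsCopy H G' φ := by
  by_contra! hfree
  have hlarge := hfar G' (free_iff_forall_not_isCopy.2 hfree)
  rw [symmDiff_of_ge (SimpleGraph.edgeSet_subset_edgeSet.2 hle)] at hlarge
  exact hlarge.not_ge hloss

theorem IsFar.exists_isCopy_family {ι : Type*} [Fintype ι] (hfar : IsFar ε (FreeOf H) G)
    {G₀ G' : ι → SimpleGraph (Fin n)} (hloss : ∑ i, (edgeLoss (G₀ i) (G' i) : ℝ) ≤ ε * n) :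
    ∃ φ, IsCopy H G φ ∧ ∀ i, IsCopy H (G₀ i) φ → IsCopy H (G' i) φ := by
  let lost : Set (Sym2 (Fin n)) := ⋃ i, (G₀ i).edgeSet \ (G' i).edgeSet
  have hlost : edgeLoss G (G.deleteEdges lost) ≤ ∑ i, edgeLoss (G₀ i) (G' i) := by
    rw [edgeLoss, SimpleGraph.edgeSet_deleteEdges, sdiff_sdiff_right_self]
    exact (Set.ncard_le_ncard inf_le_right).trans (Set.ncard_iUnion_le_of_fintype _)
  obtain ⟨φ, hφ⟩ := hfar.exists_isCopy (SimpleGraph.deleteEdges_le lost)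
    (le_trans (by exact_mod_cast hlost) hloss)
  refine ⟨φ, hφ.mono (SimpleGraph.deleteEdges_le lost), fun i hi => ⟨hφ.inj, fun p q hpq => ?_⟩⟩
  by_contra hnot
  exact (SimpleGraph.deleteEdges_adj.1 (hφ.adj p q hpq)).2
    (Set.mem_iUnion.2 ⟨i, hi.adj p q hpq, hnot⟩)

open Classical in
theorem HasBoundedExpansion.exists_clean [Fintype W] {C : GraphClass} (hC : HasBoundedExpansion C)
    (H : SimpleGraph W) (hε : 0 < ε) :
    ∃ (K : ℕ) (γ : ℝ), 0 < γ ∧ ∀ n, ∀ G ∈ C n, IsFar ε (FreeOf H) G →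
      ∃ G' r low φ, Clean H G G' r low K γ ∧ IsCopy H G' φ := by
  obtain ⟨f, hf⟩ := hC
  let p := Fintype.card W + 2
  obtain ⟨K, γ, hγ, hclean⟩ := _root_.exists_clean H (4 * 2 ^ f p) p
    (show 0 < ε / 2 ^ f p by positivity)
  refine ⟨K, γ, hγ, fun n G hG hfar => ?_⟩
  obtain ⟨c, hc⟩ := hf n G hG p
  have hdegree : ∑ v, G.degree v ≤ 4 * 2 ^ f p * Fintype.card (Fin n) := by
    simpa only [Fintype.card_fin] using
      sum_degree_le_of_isTreedepthColoring (hc.mono (Nat.le_add_left 2 _))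
  have hclass (S : {S : Finset (Fin (f p)) // S.card ≤ p}) :
      ∃ G' r low, (edgeLoss (within G {v | c v ∈ S.1}) G' : ℝ) ≤ ε / 2 ^ f p * n ∧
        Clean H G G' r low K γ := by
    obtain ⟨r, hr, hlevel⟩ := hc.exists_isTreeEmbedding S.2
    obtain ⟨G', -, hloss, low, hlow⟩ := hclean _ G _ r (within_le G _) hr hlevel hdegree
    exact ⟨G', r, low, by simpa only [Fintype.card_fin] using hloss, hlow⟩
  choose G' r low hloss hlow using hclass
  have hsum : ∑ S, (edgeLoss (within G {v | c v ∈ S.1}) (G' S) : ℝ) ≤ ε * n := by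
    have hcard : Fintype.card {S : Finset (Fin (f p)) // S.card ≤ p} ≤ 2 ^ f p :=
      (Fintype.card_subtype_le _).trans_eq (by rw [Fintype.card_finset, Fintype.card_fin])
    calc ∑ S, (edgeLoss (within G {v | c v ∈ S.1}) (G' S) : ℝ)
        ≤ Fintype.card {S : Finset (Fin (f p)) // S.card ≤ p} * (ε / 2 ^ f p * n) :=
          (Finset.sum_le_card_nsmul _ _ _ fun S _ => hloss S).trans_eq (nsmul_eq_mul _ _)
      _ ≤ 2 ^ f p * (ε / 2 ^ f p * n) := by
          gcongr
          exact_mod_cast hcard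
      _ = ε * n := by field_simp
  obtain ⟨φ, hφ, hfamily⟩ := hfar.exists_isCopy_family hsum
  let S : {S : Finset (Fin (f p)) // S.card ≤ p} :=
    ⟨Finset.univ.image (c ∘ φ), Finset.card_image_le.trans (Nat.le_add_right _ 2)⟩
  have hcolor (w : W) : c (φ w) ∈ S.1 := Finset.mem_image_of_mem (c ∘ φ) (Finset.mem_univ w)
  exact ⟨G' S, r S, low S, φ, hlow S,
    hfamily S ⟨hφ.inj, fun p q hpq => ⟨hφ.adj p q hpq, hcolor p, hcolor q⟩⟩⟩

end Far

/-! ### The tester -/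

section Tester

/-- The answer at the position `j` of a list of answers, as a number; the junk value is `0`. -/
def answerAt (l : List (Option ℕ)) (j : ℕ) : ℕ := (l.getD j none).getD 0

/-- The position at which the round of the `i`-th query starts. A round consists of `M` queries, and
each query is preceded by two coin tosses. -/
def roundStart (M i : ℕ) : ℕ := 3 * (M * (i / M))

/-- The vertex of the `i`-th query: the second coin selects one of the earlier answers of the round,
the last of which is the first coin, a random vertex. -/
def target (M : ℕ) (l : List (Option ℕ)) (i : ℕ) : ℕ :=
  answerAt l (roundStart M i + answerAt l (3 * i + 1) % (3 * i + 1 - roundStart M i))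

/-- The `i`-th query has been made at `u`, and it has been answered by `v`. -/
def QueryAnswer (M : ℕ) (l : List (Option ℕ)) (i u v : ℕ) : Prop :=
  3 * i + 2 < l.length ∧ target M l i = u ∧ l.getD (3 * i + 2) none = some v

/-- The edge between `u` and `v` has been found. -/
def FoundEdge (M : ℕ) (l : List (Option ℕ)) (u v : ℕ) : Prop :=
  ∃ i < l.length, QueryAnswer M l i u v ∨ QueryAnswer M l i v u

/-- The `i`-th digit of `c` in base `n`. The numbers below `n ^ h` encode the maps from `Fin h` to
`Fin n` by their digits, as in `finFunctionFinEquiv`. -/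
def digit (n c i : ℕ) : ℕ := c / n ^ i % n

/-- A copy of `H` has been found. -/
def Detected {h : ℕ} (M : ℕ) (H : SimpleGraph (Fin h)) (n : ℕ) (l : List (Option ℕ)) : Prop :=
  ∃ c < n ^ h, ∀ pq : Fin h × Fin h, (pq.1 = pq.2 ∨ digit n c pq.1 ≠ digit n c pq.2) ∧
    (¬ H.Adj pq.1 pq.2 ∨ FoundEdge M l (digit n c pq.1) (digit n c pq.2))

open Classical in
/-- The tester: it makes `M * R` queries at random vertices or at random vertices that have been
discovered in the same round, and accepts unless it has found a copy of `H`. -/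
noncomputable def tester {h : ℕ} (M R : ℕ) (H : SimpleGraph (Fin h)) : Procedure := fun x =>
  if x.2.length < 3 * (M * R) then
    if x.2.length % 3 = 0 then .inl (x.1 - 1)
    else if x.2.length % 3 = 1 then .inl (x.2.length - 1 - roundStart M (x.2.length / 3))
    else .inr (.inl (target M x.2 (x.2.length / 3)))
  else .inr (.inr (decide (¬ Detected M H x.1 x.2)))

section Computability

open Primrec

variable {α : Type*} [Primcodable α]

theorem primrec_answerAt {l : α → List (Option ℕ)} {f : α → ℕ} (hl : Primrec l) (hf : Primrec f) :
    Primrec fun x => answerAt (l x) (f x) :=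
  option_getD.comp ((list_getD none).comp hl hf) (const 0)

theorem primrec_roundStart (M : ℕ) {f : α → ℕ} (hf : Primrec f) :
    Primrec fun x => roundStart M (f x) :=
  nat_mul.comp (const 3) (nat_mul.comp (const M) (nat_div.comp hf (const M)))

theorem primrec_target (M : ℕ) {l : α → List (Option ℕ)} {f : α → ℕ} (hl : Primrec l)
    (hf : Primrec f) : Primrec fun x => target M (l x) (f x) := by
  have hcoin : Primrec fun x => 3 * f x + 1 := nat_add.comp (nat_mul.comp (const 3) hf) (const 1)
  exact primrec_answerAt hl (nat_add.comp (primrec_roundStart M hf)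
    (nat_mod.comp (primrec_answerAt hl hcoin) (nat_sub.comp hcoin (primrec_roundStart M hf))))

theorem primrecPred_queryAnswer (M : ℕ) {l : α → List (Option ℕ)} {f u v : α → ℕ} (hl : Primrec l)
    (hf : Primrec f) (hu : Primrec u) (hv : Primrec v) :
    PrimrecPred fun x => QueryAnswer M (l x) (f x) (u x) (v x) := by
  have hquery : Primrec fun x => 3 * f x + 2 := nat_add.comp (nat_mul.comp (const 3) hf) (const 2)
  have htarget := Primrec.eq.comp (primrec_target M hl hf) hu
  have hanswer := Primrec.eq.comp ((list_getD none).comp hl hquery) (option_some.comp hv)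
  exact (nat_lt.comp hquery (list_length.comp hl)).and (htarget.and hanswer)

theorem primrecPred_foundEdge (M : ℕ) {l : α → List (Option ℕ)} {u v : α → ℕ} (hl : Primrec l)
    (hu : Primrec u) (hv : Primrec v) : PrimrecPred fun x => FoundEdge M (l x) (u x) (v x) := by
  have hanswer : PrimrecRel fun (i : ℕ) (x : α) =>
      QueryAnswer M (l x) i (u x) (v x) ∨ QueryAnswer M (l x) i (v x) (u x) :=
    (primrecPred_queryAnswer M (hl.comp snd) fst (hu.comp snd) (hv.comp snd)).or
      (primrecPred_queryAnswer M (hl.comp snd) fst (hv.comp snd) (hu.comp snd))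
  exact (hanswer.exists_mem_list.comp (list_range.comp (list_length.comp hl)) Primrec.id).of_eq
    fun x => by simp only [List.mem_range, id_eq, FoundEdge]

theorem primrec_digit {n c i : α → ℕ} (hn : Primrec n) (hc : Primrec c) (hi : Primrec i) :
    Primrec fun x => digit (n x) (c x) (i x) :=
  nat_mod.comp (nat_div.comp hc ((Primrec₂.unpaired'.1 Nat.Primrec.pow).comp hn hi)) hn

theorem primrecPred_detected {h : ℕ} (M : ℕ) (H : SimpleGraph (Fin h)) :
    PrimrecPred fun x : ℕ × List (Option ℕ) => Detected M H x.1 x.2 := by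
  classical
  have hdigit {β : Type} [Primcodable β] {p : β → Fin h} {c : β → ℕ}
      {x : β → ℕ × List (Option ℕ)} (hp : Primrec p) (hc : Primrec c) (hx : Primrec x) :
      Primrec fun y => digit (x y).1 (c y) (p y) :=
    primrec_digit (fst.comp hx) hc (fin_val.comp hp)
  have hadj : PrimrecPred fun pq : Fin h × Fin h => H.Adj pq.1 pq.2 :=
    ⟨inferInstance, dom_finite _⟩
  have hpair : PrimrecRel fun (pq : Fin h × Fin h) (y : ℕ × (ℕ × List (Option ℕ))) =>
      (pq.1 = pq.2 ∨ digit y.2.1 y.1 pq.1 ≠ digit y.2.1 y.1 pq.2) ∧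
        (¬ H.Adj pq.1 pq.2 ∨ FoundEdge M y.2.2 (digit y.2.1 y.1 pq.1) (digit y.2.1 y.1 pq.2)) := by
    have hc : Primrec fun z : (Fin h × Fin h) × (ℕ × (ℕ × List (Option ℕ))) => z.2.1 :=
      fst.comp snd
    have hx : Primrec fun z : (Fin h × Fin h) × (ℕ × (ℕ × List (Option ℕ))) => z.2.2 :=
      snd.comp snd
    have hp := hdigit (fst.comp fst) hc hx
    have hq := hdigit (snd.comp fst) hc hx
    exact ((Primrec.eq.comp (fst.comp fst) (snd.comp fst)).or (Primrec.eq.comp hp hq).not).and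
      ((hadj.comp fst).not.or (primrecPred_foundEdge M (snd.comp hx) hp hq))
  have hall : PrimrecRel fun (c : ℕ) (x : ℕ × List (Option ℕ)) => ∀ pq : Fin h × Fin h,
      (pq.1 = pq.2 ∨ digit x.1 c pq.1 ≠ digit x.1 c pq.2) ∧
        (¬ H.Adj pq.1 pq.2 ∨ FoundEdge M x.2 (digit x.1 c pq.1) (digit x.1 c pq.2)) :=
    (hpair.forall_mem_list.comp (const Finset.univ.toList) Primrec.id).of_eq fun y => by
      simp only [Finset.mem_toList, Finset.mem_univ, true_imp_iff, id_eq]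
  have hcodes : Primrec fun x : ℕ × List (Option ℕ) => List.range (x.1 ^ h) :=
    list_range.comp ((Primrec₂.unpaired'.1 Nat.Primrec.pow).comp fst (const h))
  exact (hall.exists_mem_list.comp hcodes Primrec.id).of_eq fun x => by
    simp only [List.mem_range, id_eq, Detected]

theorem computable_tester {h : ℕ} (M R : ℕ) (H : SimpleGraph (Fin h)) :
    Computable (tester M R H) := by
  classical
  have hlen : Primrec fun x : ℕ × List (Option ℕ) => x.2.length := list_length.comp snd
  have hmod : Primrec fun x : ℕ × List (Option ℕ) => x.2.length % 3 := nat_mod.comp hlen (const 3)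
  have hdiv : Primrec fun x : ℕ × List (Option ℕ) => x.2.length / 3 := nat_div.comp hlen (const 3)
  refine Primrec.to_comp (Primrec.ite (nat_lt.comp hlen (const _))
    (Primrec.ite (Primrec.eq.comp hmod (const 0)) ?_
      (Primrec.ite (Primrec.eq.comp hmod (const 1)) ?_ ?_)) ?_)
  · exact sumInl.comp (nat_sub.comp fst (const 1))
  · exact sumInl.comp (nat_sub.comp (nat_sub.comp hlen (const 1)) (primrec_roundStart M hdiv))
  · exact sumInr.comp (sumInl.comp (primrec_target M snd hdiv))
  · exact sumInr.comp (sumInr.comp (primrecPred_detected M H).not.decide)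

end Computability

theorem answerAt_append {l : List (Option ℕ)} (l' : List (Option ℕ)) {j : ℕ} (hj : j < l.length) :
    answerAt (l ++ l') j = answerAt l j := by
  rw [answerAt, answerAt, List.getD_append _ _ _ _ hj]

theorem roundStart_le (M i : ℕ) : roundStart M i ≤ 3 * i :=
  Nat.mul_le_mul_left 3 (Nat.mul_div_le i M)

theorem roundStart_eq {M i j : ℕ} (hj : M * j ≤ i) (hi : i < M * j + M) :
    roundStart M i = 3 * (M * j) := by
  rw [roundStart, Nat.div_eq_of_lt_le (mul_comm M j ▸ hj) (by rwa [Nat.succ_mul, mul_comm])]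

theorem target_position_le (M : ℕ) (l : List (Option ℕ)) (i : ℕ) :
    roundStart M i + answerAt l (3 * i + 1) % (3 * i + 1 - roundStart M i) ≤ 3 * i := by
  have hstart := roundStart_le M i
  have hmod := Nat.mod_lt (answerAt l (3 * i + 1)) (show 0 < 3 * i + 1 - roundStart M i by omega)
  omega

theorem target_append {M : ℕ} {l : List (Option ℕ)} (l' : List (Option ℕ)) {i : ℕ}
    (hi : 3 * i + 1 < l.length) : target M (l ++ l') i = target M l i := by
  have hposition := target_position_le M l i
  unfold target
  rw [answerAt_append l' hi, answerAt_append l' (by omega)]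

theorem queryAnswer_append_iff {M : ℕ} {l : List (Option ℕ)} (l' : List (Option ℕ)) {i u v : ℕ}
    (hi : 3 * i + 2 < l.length) : QueryAnswer M (l ++ l') i u v ↔ QueryAnswer M l i u v := by
  rw [QueryAnswer, QueryAnswer, List.length_append, target_append l' (by omega),
    List.getD_append _ _ _ _ hi]
  simp only [hi, Nat.lt_add_right]

/-- The graph formed by the edges found by the queries from number `b` on. -/
def foundGraph (M n : ℕ) (l : List (Option ℕ)) (b : ℕ) : SimpleGraph (Fin n) where
  Adj u v := u ≠ v ∧ ∃ i, b ≤ i ∧ (QueryAnswer M l i u v ∨ QueryAnswer M l i v u)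
  symm := ⟨fun _ _ h => ⟨h.1.symm, h.2.imp fun _ hi => ⟨hi.1, hi.2.symm⟩⟩⟩
  loopless := ⟨fun _ h => h.1 rfl⟩

theorem foundGraph_mono (M n : ℕ) {l l' : List (Option ℕ)} (hl : l <+: l') (b : ℕ) :
    foundGraph M n l b ≤ foundGraph M n l' b := by
  obtain ⟨l', rfl⟩ := hl
  rintro u v ⟨hne, i, hi, h⟩
  exact ⟨hne, i, hi, h.imp (fun h => (queryAnswer_append_iff l' h.1).2 h)
    (fun h => (queryAnswer_append_iff l' h.1).2 h)⟩

theorem foundGraph_le_zero (M n : ℕ) (l : List (Option ℕ)) (b : ℕ) :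
    foundGraph M n l b ≤ foundGraph M n l 0 :=
  fun _ _ ⟨hne, i, _, h⟩ => ⟨hne, i, Nat.zero_le i, h⟩

theorem foundGraph_zero_adj_iff {M n : ℕ} {l : List (Option ℕ)} {u v : Fin n} :
    (foundGraph M n l 0).Adj u v ↔ u ≠ v ∧ FoundEdge M l u v := by
  refine and_congr_right fun _ => exists_congr fun i => and_congr_left fun h => ?_
  simp only [Nat.zero_le, true_iff]
  rcases h with h | h <;> have := h.1 <;> omega

theorem detected_iff {h M n : ℕ} {H : SimpleGraph (Fin h)} {l : List (Option ℕ)} :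
    Detected M H n l ↔ ∃ φ, IsCopy H (foundGraph M n l 0) φ := by
  have hdigit (φ : Fin h → Fin n) (p : Fin h) : digit n (finFunctionFinEquiv φ) p = φ p :=
    congrArg Fin.val (congrFun (finFunctionFinEquiv.symm_apply_apply φ) p)
  constructor
  · rintro ⟨c, hc, hpq⟩
    obtain ⟨φ, hφ⟩ := finFunctionFinEquiv.surjective (⟨c, hc⟩ : Fin (n ^ h))
    obtain rfl : (finFunctionFinEquiv φ : ℕ) = c := congrArg Fin.val hφ
    simp only [hdigit] at hpq
    have hinj : Function.Injective φ := fun p q heq =>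
      (hpq (p, q)).1.resolve_right (not_not.2 (congrArg Fin.val heq))
    exact ⟨φ, hinj, fun p q hadj => foundGraph_zero_adj_iff.2
      ⟨hinj.ne hadj.ne, (hpq (p, q)).2.resolve_left (not_not.2 hadj)⟩⟩
  · rintro ⟨φ, hφ⟩
    refine ⟨finFunctionFinEquiv φ, Fin.is_lt _, fun pq => ?_⟩
    rw [hdigit, hdigit]
    exact ⟨or_iff_not_imp_left.2 fun hne => Fin.val_injective.ne (hφ.inj.ne hne),
      or_iff_not_imp_left.2 fun hadj =>
        (foundGraph_zero_adj_iff.1 (hφ.adj _ _ (not_not.1 hadj))).2⟩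

theorem Detected.mono {h M n : ℕ} {H : SimpleGraph (Fin h)} {l l' : List (Option ℕ)}
    (hd : Detected M H n l) (hl : l <+: l') : Detected M H n l' := by
  obtain ⟨φ, hφ⟩ := detected_iff.1 hd
  exact detected_iff.2 ⟨φ, hφ.mono (foundGraph_mono M n hl 0)⟩

theorem exists_position_of_found {M n j i : ℕ} {l : List (Option ℕ)} (hlen : l.length = 3 * i)
    (hi : i < M * j + M) {u v : Fin n} (hF : (foundGraph M n l (M * j)).Adj u v) :
    ∃ t, 3 * (M * j) + t < 3 * i ∧ answerAt l (3 * (M * j) + t) = u := by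
  obtain ⟨-, k, hk, ⟨hlt, htarget, -⟩ | ⟨hlt, -, hanswer⟩⟩ := hF
  · have hposition := target_position_le M l k
    rw [target] at htarget
    rw [roundStart_eq hk (by omega)] at hposition htarget
    exact ⟨_, by omega, htarget⟩
  · refine ⟨3 * k + 2 - 3 * (M * j), by omega, ?_⟩
    rw [Nat.add_sub_cancel' (by omega), answerAt, hanswer, Option.getD_some]

end Tester

/-! ### Running a procedure -/

section Runs

theorem mul_le_toOuterMeasure_bind {α β : Type*} (p : PMF α) (f : α → PMF β) {A : Set α}
    {B : Set β} {a c : ℝ≥0∞} (ha : a ≤ p.toOuterMeasure A)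
    (hc : ∀ x ∈ A, c ≤ (f x).toOuterMeasure B) : a * c ≤ (p.bind f).toOuterMeasure B := by
  refine (mul_le_mul_left ha c).trans ?_
  rw [PMF.toOuterMeasure_bind_apply, PMF.toOuterMeasure_apply, ← ENNReal.tsum_mul_right]
  refine ENNReal.tsum_le_tsum fun x => ?_
  by_cases hx : x ∈ A
  · rw [Set.indicator_of_mem hx]
    exact mul_le_mul_right (hc x hx) _
  · rw [Set.indicator_of_notMem hx, zero_mul]
    exact zero_le

theorem toOuterMeasure_bind_le {α β : Type*} (p : PMF α) (f : α → PMF β) {A : Set α}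
    {B : Set β} {c : ℝ≥0∞} (hc : ∀ x ∈ p.support, x ∈ A → (f x).toOuterMeasure B ≤ c)
    (h₀ : ∀ x ∈ p.support, x ∉ A → (f x).toOuterMeasure B = 0) :
    (p.bind f).toOuterMeasure B ≤ p.toOuterMeasure A * c := by
  rw [PMF.toOuterMeasure_bind_apply, PMF.toOuterMeasure_apply, ← ENNReal.tsum_mul_right]
  refine ENNReal.tsum_le_tsum fun x => ?_
  by_cases hp : p x = 0
  · rw [hp, zero_mul]
    exact zero_le
  · have hxs : x ∈ p.support := hp
    by_cases hx : x ∈ A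
    · rw [Set.indicator_of_mem hx]
      exact mul_le_mul_right (hc x hxs hx) _
    · rw [h₀ x hxs hx, mul_zero]
      exact zero_le

theorem toOuterMeasure_add_compl {α : Type*} (p : PMF α) (A : Set α) :
    p.toOuterMeasure A + p.toOuterMeasure Aᶜ = 1 := by
  rw [PMF.toOuterMeasure_apply, PMF.toOuterMeasure_apply, ← ENNReal.tsum_add, ← p.tsum_coe]
  exact tsum_congr fun x => Set.indicator_self_add_compl_apply A p x

theorem bind_eq_self_of_support {α : Type*} {p : PMF α} {f : α → PMF α}
    (hf : ∀ x ∈ p.support, f x = PMF.pure x) : p.bind f = p := by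
  conv_rhs => rw [← p.bind_pure]
  ext y
  rw [PMF.bind_apply, PMF.bind_apply]
  refine tsum_congr fun x => ?_
  by_cases hx : p x = 0
  · rw [hx, zero_mul, zero_mul]
  · rw [hf x hx]

variable {n : ℕ} {T : Procedure} {G : SimpleGraph (Fin n)} {s s' : List (Option ℕ) × ℕ}

/-- The law of the state after `k` further steps from the state `s`. -/
noncomputable def iterStep (T : Procedure) (G : SimpleGraph (Fin n)) :
    ℕ → List (Option ℕ) × ℕ → PMF (List (Option ℕ) × ℕ)
  | 0, s => PMF.pure s
  | k + 1, s => (step T G s).bind (iterStep T G k)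

theorem iterStep_succ (T : Procedure) (G : SimpleGraph (Fin n)) (k : ℕ)
    (s : List (Option ℕ) × ℕ) : iterStep T G (k + 1) s = (step T G s).bind (iterStep T G k) :=
  rfl

theorem iterStep_add (T : Procedure) (G : SimpleGraph (Fin n)) (k k' : ℕ)
    (s : List (Option ℕ) × ℕ) :
    iterStep T G (k + k') s = (iterStep T G k s).bind (iterStep T G k') := by
  induction k generalizing s with
  | zero => rw [Nat.zero_add, iterStep, PMF.pure_bind]
  | succ k ih =>
    rw [Nat.add_right_comm, iterStep_succ, iterStep_succ, PMF.bind_bind]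
    exact congrArg _ (funext ih)

theorem run_add (T : Procedure) (G : SimpleGraph (Fin n)) (t k : ℕ) :
    run T G (t + k) = (run T G t).bind (iterStep T G k) := by
  induction k generalizing t with
  | zero => exact (PMF.bind_pure _).symm
  | succ k ih => rw [← Nat.succ_add_eq_add_succ, ih, run, PMF.bind_bind]; rfl

theorem run_eq_iterStep (T : Procedure) (G : SimpleGraph (Fin n)) (t : ℕ) :
    run T G t = iterStep T G t ([], 0) := by
  rw [← Nat.zero_add t, run_add, Nat.zero_add, run, PMF.pure_bind]

theorem le_iterStep_three {A₁ A₂ A₃ : Set (List (Option ℕ) × ℕ)} {a₁ a₂ a₃ : ℝ≥0∞}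
    (h₁ : a₁ ≤ (step T G s).toOuterMeasure A₁)
    (h₂ : ∀ s' ∈ A₁, a₂ ≤ (step T G s').toOuterMeasure A₂)
    (h₃ : ∀ s' ∈ A₂, a₃ ≤ (step T G s').toOuterMeasure A₃) :
    a₁ * (a₂ * a₃) ≤ (iterStep T G 3 s).toOuterMeasure A₃ := by
  refine mul_le_toOuterMeasure_bind _ _ h₁ fun s' hs' => ?_
  refine mul_le_toOuterMeasure_bind _ _ (h₂ s' hs') fun s'' hs'' => ?_
  rw [iterStep_succ]
  exact (h₃ s'' hs'').trans_eq (by rw [show iterStep T G 0 = PMF.pure from rfl, PMF.bind_pure])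

theorem le_step_coin (G : SimpleGraph (Fin n)) {k : ℕ} (hT : T (n, s.1) = .inl k)
    (U : Finset (Fin (k + 1))) {S : Set (List (Option ℕ) × ℕ)}
    (hS : ∀ i ∈ U, (s.1 ++ [some i.val], s.2) ∈ S) :
    (U.card : ℝ≥0∞) / (k + 1 : ℕ) ≤ (step T G s).toOuterMeasure S := by
  classical
  have hstep : step T G s = (PMF.uniformOfFintype (Fin (k + 1))).map fun i : Fin (k + 1) =>
      (s.1 ++ [some i.val], s.2) := by
    rw [step, hT]
  rw [hstep, PMF.toOuterMeasure_map_apply, PMF.toOuterMeasure_uniformOfFintype_apply,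
    Fintype.card_fin]
  refine ENNReal.div_le_div_right ?_ _
  rw [Nat.cast_le, ← Fintype.card_coe]
  exact Fintype.card_le_of_injective (fun i => ⟨i.1, hS i.1 i.2⟩)
    fun i j hij => Subtype.ext (congrArg (fun x => x.1) hij)

open Classical in
theorem le_step_query {v : Fin n} (hT : T (n, s.1) = .inr (.inl v.val)) {Y : Finset (Fin n)}
    (hY : Y ⊆ G.neighborFinset v) (hne : Y.Nonempty) {S : Set (List (Option ℕ) × ℕ)}
    (hS : ∀ y ∈ Y, (s.1 ++ [some y.val], s.2 + 1) ∈ S) :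
    (Y.card : ℝ≥0∞) / G.degree v ≤ (step T G s).toOuterMeasure S := by
  have hex : ∃ hv : v.val < n, (G.neighborFinset ⟨v.val, hv⟩).Nonempty := ⟨v.2, hne.mono hY⟩
  have hstep : step T G s = ((PMF.uniformOfFinset (G.neighborFinset v) (hne.mono hY)).map
      fun w : Fin n => some w.val).map fun a => (s.1 ++ [a], s.2 + 1) := by
    simp only [step, hT, randomNeighbor, dif_pos hex]
  rw [hstep, PMF.toOuterMeasure_map_apply, PMF.toOuterMeasure_map_apply,
    PMF.toOuterMeasure_uniformOfFinset_apply, SimpleGraph.card_neighborFinset_eq_degree]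
  refine ENNReal.div_le_div_right (Nat.cast_le.2 ?_) _
  exact Finset.card_le_card fun y hy => Finset.mem_filter.2 ⟨hY hy, hS y hy⟩

theorem eq_of_mem_support_step (hs' : s' ∈ (step T G s).support) :
    (∃ b, T (n, s.1) = .inr (.inr b) ∧ s' = s) ∨
    (∃ k i, T (n, s.1) = .inl k ∧ s' = (s.1 ++ [some i], s.2)) ∨
    (∃ v a, T (n, s.1) = .inr (.inl v) ∧ a ∈ (randomNeighbor G v).support ∧
      s' = (s.1 ++ [a], s.2 + 1)) := by
  unfold step at hs'
  split at hs'
  case h_1 k hk =>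
    obtain ⟨i, -, rfl⟩ := (PMF.mem_support_map_iff _ _ _).1 hs'
    exact Or.inr (Or.inl ⟨k, i, hk, rfl⟩)
  case h_2 v hv =>
    obtain ⟨a, ha, rfl⟩ := (PMF.mem_support_map_iff _ _ _).1 hs'
    exact Or.inr (Or.inr ⟨v, a, hv, ha, rfl⟩)
  case h_3 b hb => exact Or.inl ⟨b, hb, (PMF.mem_support_pure_iff _ _).1 hs'⟩

theorem adj_of_mem_support_randomNeighbor {u v : ℕ}
    (h : some v ∈ (randomNeighbor G u).support) :
    ∃ (hu : u < n) (hv : v < n), G.Adj ⟨u, hu⟩ ⟨v, hv⟩ := by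
  classical
  unfold randomNeighbor at h
  split_ifs at h with hex
  · obtain ⟨w, hw, hwv⟩ := (PMF.mem_support_map_iff _ _ _).1 h
    obtain rfl : w.val = v := Option.some.inj hwv
    rw [PMF.mem_support_uniformOfFinset_iff] at hw
    exact ⟨hex.choose, w.2, (SimpleGraph.mem_neighborFinset _ _ _).1 hw⟩
  · cases (PMF.mem_support_pure_iff _ _).1 h

theorem prefix_of_mem_support_iterStep {k : ℕ} (hs' : s' ∈ (iterStep T G k s).support) :
    s.1 <+: s'.1 := by
  induction k generalizing s with
  | zero => rw [(PMF.mem_support_pure_iff _ _).1 hs']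
  | succ k ih =>
    obtain ⟨s₁, hs₁, hs'⟩ := (PMF.mem_support_bind_iff _ _ _).1 hs'
    refine List.IsPrefix.trans ?_ (ih hs')
    rcases eq_of_mem_support_step hs₁ with ⟨_, -, rfl⟩ | ⟨_, _, -, rfl⟩ | ⟨_, _, -, -, rfl⟩
    exacts [List.prefix_rfl, List.prefix_append _ _, List.prefix_append _ _]

theorem queries_le_length {t : ℕ} (hs : s ∈ (run T G t).support) : s.2 ≤ s.1.length := by
  induction t generalizing s with
  | zero => rw [(PMF.mem_support_pure_iff _ _).1 hs]; rfl
  | succ t ih =>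
    obtain ⟨s₀, hs₀, hs⟩ := (PMF.mem_support_bind_iff _ _ _).1 hs
    have hle := ih hs₀
    rcases eq_of_mem_support_step hs with ⟨_, -, rfl⟩ | ⟨_, _, -, rfl⟩ | ⟨_, _, -, -, rfl⟩
    · exact hle
    all_goals
      rw [List.length_append, List.length_singleton]
      omega

theorem adj_of_answer {t j u v : ℕ} (hs : s ∈ (run T G t).support)
    (hquery : T (n, s.1.take j) = .inr (.inl u)) (hanswer : s.1[j]? = some (some v)) :
    ∃ (hu : u < n) (hv : v < n), G.Adj ⟨u, hu⟩ ⟨v, hv⟩ := by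
  induction t generalizing s with
  | zero =>
    rw [(PMF.mem_support_pure_iff _ _).1 hs] at hanswer
    cases hanswer
  | succ t ih =>
    obtain ⟨s₀, hs₀, hs⟩ := (PMF.mem_support_bind_iff _ _ _).1 hs
    have hlast {a : Option ℕ} (hs₁ : s.1 = s₀.1 ++ [a]) (hnew :
        T (n, s₀.1) = .inr (.inl u) → a = some v → some v ∈ (randomNeighbor G u).support) :
        ∃ (hu : u < n) (hv : v < n), G.Adj ⟨u, hu⟩ ⟨v, hv⟩ := by
      rw [hs₁] at hquery hanswer
      rcases lt_or_ge j s₀.1.length with hj | hj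
      · rw [List.take_append_of_le_length hj.le] at hquery
        rw [List.getElem?_append_left hj] at hanswer
        exact ih hs₀ hquery hanswer
      · obtain ⟨hj', ha⟩ := List.getElem?_eq_some_iff.1 hanswer
        obtain rfl : j = s₀.1.length := by
          rw [List.length_append, List.length_singleton] at hj'
          omega
        rw [List.take_left] at hquery
        exact adj_of_mem_support_randomNeighbor (hnew hquery (by simpa using ha))
    rcases eq_of_mem_support_step hs with ⟨_, -, rfl⟩ | ⟨k, i, hk, rfl⟩ | ⟨w, a, hw, ha, rfl⟩
    · exact ih hs₀ hquery hanswer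
    · exact hlast rfl fun hu => by simp [hk] at hu
    · refine hlast rfl fun hu hav => ?_
      obtain rfl : w = u := by simpa [hw] using hu
      exact hav ▸ ha

theorem iterStep_of_verdict (G : SimpleGraph (Fin n)) {b : Bool} (hb : T (n, s.1) = .inr (.inr b))
    (k : ℕ) : iterStep T G k s = PMF.pure s := by
  induction k with
  | zero => rfl
  | succ k ih => rw [iterStep_succ, step, hb, PMF.pure_bind, ih]

theorem run_add_of_forall_verdict {N : ℕ}
    (hN : ∀ s ∈ (run T G N).support, ∃ b, T (n, s.1) = .inr (.inr b)) (k : ℕ) :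
    run T G (N + k) = run T G N := by
  rw [run_add]
  refine bind_eq_self_of_support fun s hs => ?_
  obtain ⟨b, hb⟩ := hN s hs
  exact iterStep_of_verdict G hb k

theorem verdictProb_eq_of_forall_verdict {N : ℕ}
    (hN : ∀ s ∈ (run T G N).support, ∃ b, T (n, s.1) = .inr (.inr b)) (b : Bool) :
    verdictProb T G b = (run T G N).toOuterMeasure {s | T (n, s.1) = .inr (.inr b)} := by
  have hmap (t : ℕ) : ((run T G t).map fun s => T (n, s.1)) (.inr (.inr b)) =
      (run T G t).toOuterMeasure {s | T (n, s.1) = .inr (.inr b)} := by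
    rw [← PMF.toOuterMeasure_apply_singleton, PMF.toOuterMeasure_map_apply]
    rfl
  have hmono (t k : ℕ) : (run T G t).toOuterMeasure {s | T (n, s.1) = .inr (.inr b)} ≤
      (run T G (t + k)).toOuterMeasure {s | T (n, s.1) = .inr (.inr b)} := by
    rw [run_add, ← mul_one ((run T G t).toOuterMeasure _)]
    refine mul_le_toOuterMeasure_bind _ _ le_rfl fun s hs => ?_
    rw [iterStep_of_verdict G hs, PMF.toOuterMeasure_pure_apply, if_pos hs]
  simp only [verdictProb, hmap]
  refine le_antisymm (iSup_le fun t => ?_) (le_iSup (fun t => (run T G t).toOuterMeasure _) N)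
  refine (hmono t N).trans_eq ?_
  rw [Nat.add_comm, run_add_of_forall_verdict hN]

end Runs

/-! ### Runs of the tester -/

section TesterRuns

variable {h n M R : ℕ} {H : SimpleGraph (Fin h)} {G : SimpleGraph (Fin n)}
  {s s' : List (Option ℕ) × ℕ}

theorem tester_first_coin {l : List (Option ℕ)} {i : ℕ} (hl : l.length = 3 * i) (hi : i < M * R) :
    tester M R H (n, l) = .inl (n - 1) := by
  have hlt : l.length < 3 * (M * R) := by omega
  have h₀ : l.length % 3 = 0 := by omega
  simp only [tester, if_pos hlt, if_pos h₀]

theorem tester_second_coin {l : List (Option ℕ)} {i : ℕ} (hl : l.length = 3 * i + 1)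
    (hi : i < M * R) : tester M R H (n, l) = .inl (3 * i - roundStart M i) := by
  have hlt : l.length < 3 * (M * R) := by omega
  have h₀ : ¬ l.length % 3 = 0 := by omega
  have h₁ : l.length % 3 = 1 := by omega
  simp only [tester, if_pos hlt, if_neg h₀, if_pos h₁]
  rw [show l.length - 1 = 3 * i by omega, show l.length / 3 = i by omega]

theorem tester_query {l : List (Option ℕ)} {i : ℕ} (hl : l.length = 3 * i + 2) (hi : i < M * R) :
    tester M R H (n, l) = .inr (.inl (target M l i)) := by
  have hlt : l.length < 3 * (M * R) := by omega
  have h₀ : ¬ l.length % 3 = 0 := by omega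
  have h₁ : ¬ l.length % 3 = 1 := by omega
  simp only [tester, if_pos hlt, if_neg h₀, if_neg h₁]
  rw [show l.length / 3 = i by omega]

open Classical in
theorem tester_verdict {l : List (Option ℕ)} (hl : 3 * (M * R) ≤ l.length) :
    tester M R H (n, l) = .inr (.inr (decide (¬ Detected M H n l))) := by
  simp only [tester, if_neg (not_lt.2 hl)]

theorem le_length_of_tester_eq_verdict {l : List (Option ℕ)} {b : Bool}
    (hb : tester M R H (n, l) = .inr (.inr b)) : 3 * (M * R) ≤ l.length := by
  by_contra! hlt
  have hi : l.length / 3 < M * R := by omega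
  obtain hl | hl | hl : l.length = 3 * (l.length / 3) ∨ l.length = 3 * (l.length / 3) + 1 ∨
      l.length = 3 * (l.length / 3) + 2 := by omega
  · cases (tester_first_coin hl hi).symm.trans hb
  · cases (tester_second_coin hl hi).symm.trans hb
  · cases (tester_query hl hi).symm.trans hb

theorem length_of_mem_support_iterStep_tester {k : ℕ}
    (hs' : s' ∈ (iterStep (tester M R H) G k s).support) (hk : s.1.length + k ≤ 3 * (M * R)) :
    s'.1.length = s.1.length + k := by
  induction k generalizing s with
  | zero => rw [(PMF.mem_support_pure_iff _ _).1 hs', Nat.add_zero]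
  | succ k ih =>
    obtain ⟨s₁, hs₁, hs'⟩ := (PMF.mem_support_bind_iff _ _ _).1 hs'
    have hlen : s₁.1.length = s.1.length + 1 := by
      rcases eq_of_mem_support_step hs₁ with ⟨_, hb, -⟩ | ⟨_, _, -, rfl⟩ | ⟨_, _, -, -, rfl⟩
      · have hle := le_length_of_tester_eq_verdict hb
        omega
      all_goals exact List.length_append
    rw [ih hs' (by omega), hlen, Nat.add_right_comm, Nat.add_assoc]

theorem length_of_mem_support_run_tester {t : ℕ} (hs : s ∈ (run (tester M R H) G t).support)
    (ht : t ≤ 3 * (M * R)) : s.1.length = t := by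
  rw [run_eq_iterStep] at hs
  rw [length_of_mem_support_iterStep_tester hs (by simpa using ht), List.length_nil, Nat.zero_add]

theorem exists_tester_eq_verdict (hs : s ∈ (run (tester M R H) G (3 * (M * R))).support) :
    ∃ b, tester M R H (n, s.1) = .inr (.inr b) :=
  ⟨_, tester_verdict (length_of_mem_support_run_tester hs le_rfl).ge⟩

theorem length_le_of_mem_support_run_tester {t : ℕ}
    (hs : s ∈ (run (tester M R H) G t).support) : s.1.length ≤ 3 * (M * R) := by
  rcases le_total t (3 * (M * R)) with ht | ht
  · exact (length_of_mem_support_run_tester hs ht).trans_le ht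
  · obtain ⟨k, rfl⟩ := Nat.exists_eq_add_of_le ht
    rw [run_add_of_forall_verdict fun _ => exists_tester_eq_verdict] at hs
    exact (length_of_mem_support_run_tester hs le_rfl).le

theorem adj_of_queryAnswer {t i : ℕ} {u v : Fin n} (hs : s ∈ (run (tester M R H) G t).support)
    (hq : QueryAnswer M s.1 i u v) : G.Adj u v := by
  obtain ⟨hlen, htarget, hanswer⟩ := hq
  have hle := length_le_of_mem_support_run_tester hs
  have htake : (s.1.take (3 * i + 2)).length = 3 * i + 2 := List.length_take_of_le hlen.le
  have hquery : tester M R H (n, s.1.take (3 * i + 2)) = .inr (.inl u) := by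
    rw [tester_query htake (by omega), ← target_append (s.1.drop (3 * i + 2)) (by omega),
      List.take_append_drop, htarget]
  obtain ⟨_, _, hadj⟩ := adj_of_answer hs hquery (v := v) (by
    rw [List.getElem?_eq_getElem hlen, ← List.getD_eq_getElem _ none hlen, hanswer])
  exact hadj

theorem foundGraph_le {t : ℕ} (hs : s ∈ (run (tester M R H) G t).support) (b : ℕ) :
    foundGraph M n s.1 b ≤ G := by
  rintro u v ⟨-, i, -, hq | hq⟩
  · exact adj_of_queryAnswer hs hq
  · exact (adj_of_queryAnswer hs hq).symm

open Classical in
theorem verdictProb_tester (b : Bool) :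
    verdictProb (tester M R H) G b = (run (tester M R H) G (3 * (M * R))).toOuterMeasure
      {s | decide (¬ Detected M H n s.1) = b} := by
  rw [verdictProb_eq_of_forall_verdict fun _ => exists_tester_eq_verdict]
  refine PMF.toOuterMeasure_apply_eq_of_inter_support_eq _ (Set.ext fun s => ?_)
  refine and_congr_left fun hs => ?_
  rw [Set.mem_ofPred_eq, tester_verdict (length_of_mem_support_run_tester hs le_rfl).ge,
    Sum.inr.injEq, Sum.inr.injEq, Set.mem_ofPred_eq]

theorem acceptProb_tester : acceptProb (tester M R H) G =
    (run (tester M R H) G (3 * (M * R))).toOuterMeasure {s | Detected M H n s.1}ᶜ := by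
  simp only [acceptProb, verdictProb_tester, decide_eq_true_eq, Set.compl_ofPred]

theorem rejectProb_tester : rejectProb (tester M R H) G =
    (run (tester M R H) G (3 * (M * R))).toOuterMeasure {s | Detected M H n s.1} := by
  simp only [rejectProb, verdictProb_tester, decide_eq_false_iff_not, not_not]

theorem isAlgorithm_tester (M R : ℕ) (H : SimpleGraph (Fin h)) : IsAlgorithm (tester M R H) := by
  refine ⟨computable_tester M R H, fun n G => ?_⟩
  rw [acceptProb_tester, rejectProb_tester, add_comm, toOuterMeasure_add_compl]

theorem hasQueryBound_tester (M R : ℕ) (H : SimpleGraph (Fin h)) :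
    HasQueryBound (tester M R H) (3 * (M * R)) :=
  fun _ _ _ _ hs => (queries_le_length hs).trans (length_le_of_mem_support_run_tester hs)

theorem hasOneSidedError_tester (M R : ℕ) (H : SimpleGraph (Fin h)) :
    HasOneSidedError (tester M R H) (FreeOf H) := by
  intro n G hG
  rw [acceptProb_tester, PMF.toOuterMeasure_apply_eq_one_iff]
  intro s hs hdetected
  obtain ⟨φ, hφ⟩ := detected_iff.1 hdetected
  exact free_iff_forall_not_isCopy.1 hG φ (hφ.mono (foundGraph_le hs 0))

end TesterRuns

/-! ### The success probability -/

section Success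

variable {h n M R : ℕ} {H : SimpleGraph (Fin h)} {G G' : SimpleGraph (Fin n)}
  {r : Fin n → Fin n → Prop} {low : Set (Fin n)} {K D : ℕ} {γ : ℝ}

theorem inv_natCast_le_one {k : ℕ} (hk : 0 < k) : (k : ℝ≥0∞)⁻¹ ≤ 1 :=
  ENNReal.inv_le_one.2 (Nat.one_le_cast.2 hk)

theorem inv_natCast_le_div {D a b : ℕ} (hD : 0 < D) (ha : 0 < a) (hab : a ≤ D * b) :
    (D : ℝ≥0∞)⁻¹ ≤ (b : ℝ≥0∞) / a := by
  rw [ENNReal.le_div_iff_mul_le (Or.inl (Nat.cast_ne_zero.2 ha.ne'))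
      (Or.inl (ENNReal.natCast_ne_top a)), mul_comm, ← div_eq_mul_inv,
    ENNReal.div_le_iff (Nat.cast_ne_zero.2 hD.ne') (ENNReal.natCast_ne_top D), mul_comm]
  exact_mod_cast hab

open Classical in
theorem inv_le_step_query {T : Procedure} {s : List (Option ℕ) × ℕ} {v : Fin n}
    (hT : T (n, s.1) = .inr (.inl v.val)) {Y : Finset (Fin n)} (hY : Y ⊆ G.neighborFinset v)
    (hne : Y.Nonempty) (hD : G.degree v ≤ D * Y.card) {S : Set (List (Option ℕ) × ℕ)}
    (hS : ∀ y ∈ Y, (s.1 ++ [some y.val], s.2 + 1) ∈ S) :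
    (D : ℝ≥0∞)⁻¹ ≤ (step T G s).toOuterMeasure S := by
  have hdeg : 0 < G.degree v := by
    rw [← SimpleGraph.card_neighborFinset_eq_degree]
    exact (hne.mono hY).card_pos
  have hD₀ : 0 < D := Nat.pos_of_mul_pos_right (hdeg.trans_le hD)
  exact (inv_natCast_le_div hD₀ hdeg hD).trans (le_step_query hT hY hne hS)

theorem inv_le_step_second_coin {s : List (Option ℕ) × ℕ} {i j t : ℕ}
    (hlen : s.1.length = 3 * i + 1) (hi : i < M * R) (hj : M * j ≤ i) (hj' : i < M * j + M)
    (ht : 3 * (M * j) + t ≤ 3 * i) {S : Set (List (Option ℕ) × ℕ)}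
    (hS : (s.1 ++ [some t], s.2) ∈ S) :
    ((3 * M : ℕ) : ℝ≥0∞)⁻¹ ≤ (step (tester M R H) G s).toOuterMeasure S := by
  have hstart := roundStart_eq hj hj'
  have ht' : t < 3 * i - roundStart M i + 1 := by omega
  refine le_trans ?_ (le_step_coin G (tester_second_coin hlen hi) {⟨t, ht'⟩} fun c hc => ?_)
  · exact inv_natCast_le_div (by omega) (Nat.succ_pos _) (by rw [Finset.card_singleton]; omega)
  · rw [Finset.mem_singleton.1 hc]
    exact hS

theorem target_second_coin {l : List (Option ℕ)} {i j t : ℕ} (hl : l.length = 3 * i + 1)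
    (hj : M * j ≤ i) (hj' : i < M * j + M) (ht : 3 * (M * j) + t ≤ 3 * i) :
    target M (l ++ [some t]) i = answerAt l (3 * (M * j) + t) := by
  have hcoin : answerAt (l ++ [some t]) (3 * i + 1) = t := by
    rw [answerAt, ← hl, List.getD_append_right _ _ _ _ le_rfl, Nat.sub_self]
    rfl
  rw [target, hcoin, roundStart_eq hj hj', Nat.mod_eq_of_lt (by omega),
    answerAt_append _ (by omega)]

theorem foundGraph_adj_of_query {l : List (Option ℕ)} {i b : ℕ} {v y : Fin n}
    (hl : l.length = 3 * i + 2) (htarget : target M l i = v) (hb : b ≤ i) (hne : v ≠ y) :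
    (foundGraph M n (l ++ [some y.val]) b).Adj v y := by
  refine ⟨hne, i, hb, Or.inl ⟨?_, ?_, ?_⟩⟩
  · rw [List.length_append, List.length_singleton]
    omega
  · rw [target_append _ (by omega), htarget]
  · rw [← hl, List.getD_append_right _ _ _ _ le_rfl, Nat.sub_self]
    rfl

open Classical in
/-- The three factors belong to the random vertex, the choice of the vertex to query, and the
answer of the oracle. -/
theorem le_iterStep_tester {s : List (Option ℕ) × ℕ} {i j : ℕ} (hlen : s.1.length = 3 * i)
    (hi : i < M * R) (hj : M * j ≤ i) (hj' : i < M * j + M) (U : Finset (Fin (n - 1 + 1)))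
    (P : SimpleGraph (Fin n) → Prop)
    (hU : ∀ u ∈ U, ∃ (t : ℕ) (v : Fin n) (Y : Finset (Fin n)), 3 * (M * j) + t ≤ 3 * i ∧
      answerAt (s.1 ++ [some u.val]) (3 * (M * j) + t) = v ∧ Y ⊆ G.neighborFinset v ∧ Y.Nonempty ∧
      G.degree v ≤ D * Y.card ∧
      ∀ y ∈ Y, ∀ F, foundGraph M n s.1 (M * j) ≤ F → F.Adj v y → P F) :
    (U.card : ℝ≥0∞) / (n - 1 + 1 : ℕ) * (((3 * M : ℕ) : ℝ≥0∞)⁻¹ * (D : ℝ≥0∞)⁻¹) ≤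
      (iterStep (tester M R H) G 3 s).toOuterMeasure
        {s' | s'.1.length = 3 * (i + 1) ∧ P (foundGraph M n s'.1 (M * j))} := by
  choose! t hU using hU
  let A₁ : Set (List (Option ℕ) × ℕ) := {s' | ∃ u ∈ U, s'.1 = s.1 ++ [some u.val]}
  let A₂ : Set (List (Option ℕ) × ℕ) :=
    {s' | ∃ u ∈ U, s'.1 = s.1 ++ [some u.val] ++ [some (t u)]}
  have hlen₁ (a : Option ℕ) : (s.1 ++ [a]).length = 3 * i + 1 := by
    rw [List.length_append, hlen, List.length_singleton]
  have hlen₂ (a b : Option ℕ) : (s.1 ++ [a] ++ [b]).length = 3 * i + 2 := by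
    rw [List.length_append, hlen₁, List.length_singleton]
  refine le_iterStep_three (A₁ := A₁) (A₂ := A₂) ?_ ?_ ?_
  · exact le_step_coin G (tester_first_coin hlen hi) U fun u hu => ⟨u, hu, rfl⟩
  · rintro s' ⟨u, hu, hs'⟩
    obtain ⟨-, -, ht, -⟩ := hU u hu
    exact inv_le_step_second_coin (hs' ▸ hlen₁ _) hi hj hj' ht ⟨u, hu, by rw [hs']⟩
  · rintro s' ⟨u, hu, hs'⟩
    obtain ⟨v, Y, ht, hv, hY, hne, hD, hP⟩ := hU u hu
    have hlen' : s'.1.length = 3 * i + 2 := hs' ▸ hlen₂ _ _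
    have htarget : target M s'.1 i = v := by
      rw [hs', target_second_coin (hlen₁ _) hj hj' ht, hv]
    refine inv_le_step_query (by rw [tester_query hlen' hi, htarget]) hY hne hD fun y hy => ⟨?_, ?_⟩
    · rw [List.length_append, hlen', List.length_singleton]
      rfl
    · have hprefix : s.1 <+: s'.1 ++ [some y.val] := by
        rw [hs', List.append_assoc, List.append_assoc]
        exact List.prefix_append _ _
      have hvy : G.Adj v y := (SimpleGraph.mem_neighborFinset _ _ _).1 (hY hy)
      exact hP y hy _ (foundGraph_mono M n hprefix _)
        (foundGraph_adj_of_query hlen' htarget hj hvy.ne)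

/-- A lower bound for the probability that the next query makes progress: the first coin hits a
set of density `1 / D`, the second coin takes a given one of at most `3 * M` values, and the
answer hits a set of density `1 / D` among the neighbors. -/
noncomputable def progressProb (M D : ℕ) : ℝ≥0∞ :=
  (D : ℝ≥0∞)⁻¹ * (((3 * M : ℕ) : ℝ≥0∞)⁻¹ * (D : ℝ≥0∞)⁻¹)

theorem progressProb_le_one (hM : 0 < M) (hD : 0 < D) : progressProb M D ≤ 1 :=
  mul_le_one' (inv_natCast_le_one hD)
    (mul_le_one' (inv_natCast_le_one (by omega)) (inv_natCast_le_one hD))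

theorem progressProb_pos (M D : ℕ) : 0 < progressProb M D := by
  have hinv (k : ℕ) : (k : ℝ≥0∞)⁻¹ ≠ 0 := ENNReal.inv_ne_zero.2 (ENNReal.natCast_ne_top k)
  exact pos_iff_ne_zero.2 (mul_ne_zero (hinv _) (mul_ne_zero (hinv _) (hinv _)))

theorem exists_one_sub_progressProb_pow_le (M D : ℕ) :
    ∃ R, (1 - progressProb M D ^ M) ^ R ≤ 1 / 3 := by
  have hlt : 1 - progressProb M D ^ M < 1 :=
    ENNReal.sub_lt_self ENNReal.one_ne_top one_ne_zero
      (ENNReal.pow_pos (progressProb_pos M D) M).ne'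
  have htendsto := ENNReal.tendsto_pow_atTop_nhds_zero_of_lt_one hlt
  have hpos : (0 : ℝ≥0∞) < 1 / 3 := ENNReal.div_pos one_ne_zero (ENNReal.natCast_ne_top 3)
  exact (htendsto.eventually (ge_mem_nhds hpos)).exists

theorem le_mul_of_one_div_mul_le (hD : 0 < D) {a b : ℕ} (hab : 1 / (D : ℝ) * a ≤ b) :
    a ≤ D * b := by
  rw [div_mul_eq_mul_div, one_mul, div_le_iff₀ (Nat.cast_pos.2 hD), mul_comm] at hab
  exact_mod_cast hab

theorem progressProb_le_of_edgeProgress (hD : 0 < D) {s : List (Option ℕ) × ℕ} {i j : ℕ}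
    (hlen : s.1.length = 3 * i) (hi : i < M * R) (hj : M * j ≤ i) (hj' : i < M * j + M)
    {P : SimpleGraph (Fin n) → Prop}
    (hP : EdgeProgress (1 / (D : ℝ)) G (foundGraph M n s.1 (M * j)) P) :
    progressProb M D ≤ (iterStep (tester M R H) G 3 s).toOuterMeasure
      {s' | s'.1.length = 3 * (i + 1) ∧ P (foundGraph M n s'.1 (M * j))} := by
  classical
  obtain ⟨v, u, huv, Y, hY, hne, hYD, hP⟩ := hP
  obtain ⟨t, ht, hv⟩ := exists_position_of_found hlen hj' huv
  refine le_trans ?_ (le_iterStep_tester (D := D) hlen hi hj hj' Finset.univ P fun u' _ =>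
    ⟨t, v, Y, ht.le, ?_, hY, hne, le_mul_of_one_div_mul_le hD hYD, hP⟩)
  · rw [Finset.card_univ, Fintype.card_fin, ENNReal.div_self
      (Nat.cast_ne_zero.2 (Nat.succ_ne_zero _)) (ENNReal.natCast_ne_top _), progressProb]
    exact mul_le_mul_left (inv_natCast_le_one hD) _
  · rw [answerAt_append _ (by omega), hv]

theorem progressProb_le_of_vertexProgress (hD : 0 < D) (hDK : K ≤ D) {s : List (Option ℕ) × ℕ}
    {i j : ℕ} (hlen : s.1.length = 3 * i) (hi : i < M * R) (hj : M * j ≤ i) (hj' : i < M * j + M)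
    {P : SimpleGraph (Fin n) → Prop}
    (hP : VertexProgress (1 / (D : ℝ)) K G (foundGraph M n s.1 (M * j)) P) :
    progressProb M D ≤ (iterStep (tester M R H) G 3 s).toOuterMeasure
      {s' | s'.1.length = 3 * (i + 1) ∧ P (foundGraph M n s'.1 (M * j))} := by
  classical
  obtain ⟨Y, hne, hYD, hP⟩ := hP
  have hn : 0 < n := Fin.pos_iff_nonempty.2 ⟨hne.choose⟩
  have hn' : n ≤ n - 1 + 1 := by omega
  refine le_trans ?_ (le_iterStep_tester (D := D) hlen hi hj hj' (Y.map (Fin.castLEEmb hn')) P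
    fun u hu => ?_)
  · rw [Fintype.card_fin] at hYD
    rw [Finset.card_map, Nat.sub_add_cancel hn, progressProb]
    exact mul_le_mul_left (inv_natCast_le_div hD hn (le_mul_of_one_div_mul_le hD hYD)) _
  · obtain ⟨y, hy, rfl⟩ := Finset.mem_map.1 hu
    obtain ⟨hdeg, z, hyz, hP⟩ := hP y hy
    refine ⟨3 * i - 3 * (M * j), y, {z}, by omega, ?_, ?_, Finset.singleton_nonempty z, ?_, ?_⟩
    · rw [Nat.add_sub_cancel' (by omega), answerAt, ← hlen,
        List.getD_append_right _ _ _ _ le_rfl, Nat.sub_self]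
      rfl
    · rwa [Finset.singleton_subset_iff, SimpleGraph.mem_neighborFinset]
    · rw [Finset.card_singleton, mul_one]
      exact hdeg.trans hDK
    · intro w hw F hF hadj
      exact hP F hF (Finset.mem_singleton.1 hw ▸ hadj)

theorem progressProb_le_iterStep (hc : Clean H G G' r low K γ) (hD : 0 < D)
    (hDγ : 1 / (D : ℝ) ≤ γ) (hDK : K ≤ D) {s : List (Option ℕ) × ℕ} {i j m : ℕ}
    (hlen : s.1.length = 3 * i) (hi : i < M * R) (hj : M * j ≤ i) (hj' : i < M * j + M)
    (hex : Explorable H G' r low (m + 1) (foundGraph M n s.1 (M * j))) :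
    progressProb M D ≤ (iterStep (tester M R H) G 3 s).toOuterMeasure
      {s' | s'.1.length = 3 * (i + 1) ∧ Explorable H G' r low m (foundGraph M n s'.1 (M * j))} := by
  have hδK : 1 / (D : ℝ) * K ≤ 1 := by
    rw [div_mul_eq_mul_div, one_mul, div_le_one (Nat.cast_pos.2 hD)]
    exact_mod_cast hDK
  rcases hex.progress hc hDγ hδK (by positivity) with hdone | hedge | hvertex
  · refine (progressProb_le_one (by omega) hD).trans_eq (Eq.symm ?_)
    rw [PMF.toOuterMeasure_apply_eq_one_iff]
    refine fun s' hs' => ⟨?_, ?_⟩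
    · rw [length_of_mem_support_iterStep_tester hs' (by omega), hlen]
      rfl
    · exact hdone.mono le_rfl (foundGraph_mono M n (prefix_of_mem_support_iterStep hs') _)
  · exact progressProb_le_of_edgeProgress hD hlen hi hj hj' hedge
  · exact progressProb_le_of_vertexProgress hD hDK hlen hi hj hj' hvertex

theorem pow_progressProb_le_iterStep (hc : Clean H G G' r low K γ) (hD : 0 < D)
    (hDγ : 1 / (D : ℝ) ≤ γ) (hDK : K ≤ D) {j : ℕ} (hjR : j < R) (k : ℕ)
    {s : List (Option ℕ) × ℕ} {i : ℕ} (hlen : s.1.length = 3 * i) (hj : M * j ≤ i)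
    (hik : i + k ≤ M * j + M) (hex : Explorable H G' r low k (foundGraph M n s.1 (M * j))) :
    progressProb M D ^ k ≤ (iterStep (tester M R H) G (3 * k) s).toOuterMeasure
      {s' | Detected M H n s'.1} := by
  induction k generalizing s i with
  | zero =>
    obtain ⟨φ, hφ⟩ := hex.exists_isCopy
    have hdetected : s ∈ {s' : List (Option ℕ) × ℕ | Detected M H n s'.1} :=
      detected_iff.2 ⟨φ, hφ.mono (foundGraph_le_zero M n s.1 _)⟩
    rw [pow_zero, mul_zero, iterStep, PMF.toOuterMeasure_pure_apply, if_pos hdetected]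
  | succ k ih =>
    have hiR : i < M * R := by
      have hround : M * (j + 1) ≤ M * R := Nat.mul_le_mul_left _ hjR
      rw [Nat.mul_succ] at hround
      omega
    rw [show 3 * (k + 1) = 3 + 3 * k by ring, iterStep_add, pow_succ']
    refine mul_le_toOuterMeasure_bind _ _
      (progressProb_le_iterStep hc hD hDγ hDK hlen hiR hj (by omega) hex) ?_
    rintro s' ⟨hlen', hex'⟩
    exact ih hlen' (by omega) (by omega) hex'

theorem round_not_detected_le (hc : Clean H G G' r low K γ) (hD : 0 < D)
    (hDγ : 1 / (D : ℝ) ≤ γ) (hDK : K ≤ D) (hM : H.edgeSet.ncard ≤ M) {φ : Fin h → Fin n}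
    (hφ : IsCopy H G' φ) {j : ℕ} (hjR : j < R) {s : List (Option ℕ) × ℕ}
    (hlen : s.1.length = 3 * (M * j)) :
    (iterStep (tester M R H) G (3 * M) s).toOuterMeasure {s' | Detected M H n s'.1}ᶜ ≤
      1 - progressProb M D ^ M := by
  have hex : Explorable H G' r low M (foundGraph M n s.1 (M * j)) := hφ.explorable.mono hM le_rfl
  have hsuccess := pow_progressProb_le_iterStep (G := G) hc hD hDγ hDK hjR M hlen le_rfl le_rfl hex
  have htotal := toOuterMeasure_add_compl (iterStep (tester M R H) G (3 * M) s)
    {s' | Detected M H n s'.1}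
  refine ENNReal.le_sub_of_add_le_right (ne_top_of_le_ne_top ENNReal.one_ne_top
    (hsuccess.trans (htotal ▸ le_self_add))) ?_
  rw [← htotal, add_comm]
  exact add_le_add_left hsuccess _

theorem run_not_detected_le (hc : Clean H G G' r low K γ) (hD : 0 < D)
    (hDγ : 1 / (D : ℝ) ≤ γ) (hDK : K ≤ D) (hM : H.edgeSet.ncard ≤ M) {φ : Fin h → Fin n}
    (hφ : IsCopy H G' φ) (j : ℕ) (hjR : j ≤ R) :
    (run (tester M R H) G (3 * (M * j))).toOuterMeasure {s | Detected M H n s.1}ᶜ ≤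
      (1 - progressProb M D ^ M) ^ j := by
  induction j with
  | zero =>
    rw [pow_zero, ← toOuterMeasure_add_compl (run (tester M R H) G (3 * (M * 0)))
      {s | Detected M H n s.1}]
    exact le_add_self
  | succ j ih =>
    rw [Nat.mul_succ, Nat.mul_add, run_add, pow_succ]
    refine (toOuterMeasure_bind_le (A := {s : List (Option ℕ) × ℕ | Detected M H n s.1}ᶜ)
      (c := 1 - progressProb M D ^ M) _ _ (fun s hs _ => ?_) (fun s _ hs => ?_)).trans
        (mul_le_mul_left (ih (by omega)) _)
    · have hlen := length_of_mem_support_run_tester hs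
        (Nat.mul_le_mul_left 3 (Nat.mul_le_mul_left M (by omega)))
      exact round_not_detected_le hc hD hDγ hDK hM hφ hjR hlen
    · rw [PMF.toOuterMeasure_apply_eq_zero_iff, Set.disjoint_left]
      exact fun s' hs' => not_not.2 ((not_not.1 hs).mono (prefix_of_mem_support_iterStep hs'))

theorem two_thirds_le_rejectProb (hc : Clean H G G' r low K γ) (hD : 0 < D)
    (hDγ : 1 / (D : ℝ) ≤ γ) (hDK : K ≤ D) (hM : H.edgeSet.ncard ≤ M) {φ : Fin h → Fin n}
    (hφ : IsCopy H G' φ) (hR : (1 - progressProb M D ^ M) ^ R ≤ 1 / 3) :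
    2 / 3 ≤ rejectProb (tester M R H) G := by
  have hfail := (run_not_detected_le hc hD hDγ hDK hM hφ R le_rfl).trans hR
  have htotal := toOuterMeasure_add_compl (run (tester M R H) G (3 * (M * R)))
    {s | Detected M H n s.1}
  rw [← rejectProb_tester] at htotal
  have hthirds : (2 / 3 + 1 / 3 : ℝ≥0∞) = 1 := by
    rw [← ENNReal.add_div, two_add_one_eq_three]
    exact ENNReal.div_self three_ne_zero (ENNReal.natCast_ne_top 3)
  refine ENNReal.le_of_add_le_add_right (ne_top_of_le_ne_top ENNReal.one_ne_top
    (hfail.trans (le_add_self.trans_eq hthirds))) ?_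
  rw [htotal]
  exact (add_le_add_right hfail _).trans_eq hthirds

end Success

theorem exists_natCast_one_div_le (K : ℕ) {γ : ℝ} (hγ : 0 < γ) :
    ∃ D : ℕ, 0 < D ∧ K ≤ D ∧ 1 / (D : ℝ) ≤ γ := by
  obtain ⟨N, hN⟩ := exists_nat_one_div_lt hγ
  have hle : (N : ℝ) + 1 ≤ (K + N + 1 : ℕ) := by exact_mod_cast (by omega : N + 1 ≤ K + N + 1)
  exact ⟨K + N + 1, by omega, by omega, (one_div_le_one_div_of_le (by positivity) hle).trans hN.le⟩

theorem exists_tester_of_hasBoundedExpansion {C : GraphClass} (hC : HasBoundedExpansion C) {h : ℕ}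
    (H : SimpleGraph (Fin h)) {ε : ℝ} (hε : 0 < ε) :
    ∃ (q : ℕ) (T : Procedure),
      IsTester T C (FreeOf H) ε ∧ HasQueryBound T q ∧ HasOneSidedError T (FreeOf H) := by
  obtain ⟨K, γ, hγ, hclean⟩ := hC.exists_clean H hε
  obtain ⟨D, hD, hDK, hDγ⟩ := exists_natCast_one_div_le K hγ
  let M := H.edgeSet.ncard
  obtain ⟨R, hR⟩ := exists_one_sub_progressProb_pow_le M D
  refine ⟨3 * (M * R), tester M R H, ⟨isAlgorithm_tester M R H, fun n G hG => ⟨fun hfree => ?_,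
    fun hfar => ?_⟩⟩, hasQueryBound_tester M R H, hasOneSidedError_tester M R H⟩
  · rw [hasOneSidedError_tester M R H n G hfree]
    exact ENNReal.div_le_of_le_mul (by norm_num)
  · obtain ⟨G', r, low, φ, hc, hφ⟩ := hclean n G hG hfar
    exact two_thirds_le_rejectProb hc hD hDγ hDK le_rfl hφ hR

theorem mainTheorem1 (C : GraphClass) (hC : HasBoundedExpansion C)
    {W : Type*} [Finite W] (H : SimpleGraph W) (ε : ℝ) (hε : 0 < ε) :
    ∃ (q : ℕ) (T : Procedure),
      IsTester T C (FreeOf H) ε ∧ HasQueryBound T q ∧ HasOneSidedError T (FreeOf H) := by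
  obtain ⟨h, ⟨e⟩⟩ := Finite.exists_equiv_fin W
  have hfree : FreeOf H = FreeOf (H.map e.toEmbedding) := by
    funext n
    ext G
    exact SimpleGraph.free_congr (SimpleGraph.Iso.map e H) SimpleGraph.Iso.refl
  rw [hfree]
  exact exists_tester_of_hasBoundedExpansion hC _ hε
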